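/- **Setting.** Let $\mathcal A$ be a finite non-empty set of actions, $D\ge 1$, $B>0$, $R\ge 0$, $\epsilon\ge 0$, and let $x\mapsto\widetilde x$ map $\mathcal A$ into the unit ball of $\mathbb R^D$. The mean reward is $g(x)=\langle\theta,\widetilde x\rangle+\omega(x)$ with $\theta\in\mathbb R^D$, $\|\theta\|_2\le B$, and $|\omega(x)|\le\epsilon$, $|g(x)|\le B$ for all $x\in\mathcal A$. In round $t=1,\dots,T$ a learner selects $x_t\in\mathcal A$ and observes $y_t=g(x_t)+\varepsilon_t$, where, for a filtration $(\mathcal F_t)$, $x_t$ is $\mathcal F_t$-measurable, $y_t$ is $\mathcal F_{t+1}$-measurable, and the noise is conditionally $R$-sub-Gaussian: $\mathbb E[\exp(\xi\varepsilon_t)\mid\mathcal F_t]\le\exp(\xi^2R^2/2)$ a.s. for all $\xi\in\mathbb R$. The regret is $R(T)=\sum_{t=1}^T\bigl(\sup_{x\in\mathcal A}g(x)-g(x_t)\bigr)$. **Algorithm.** Let $\lambda\ge 1$ and $\delta\in(0,1)$. Put $A_t=\lambda 1_D+\sum_{s=1}^t\widetilde x_s\widetilde x_s^{\mathrm T}$,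 $\hat\theta_t=A_t^{-1}\sum_{s=1}^t y_s\widetilde x_s$, $\|v\|_{A^{-1}}=\sqrt{v^{\mathrm T}A^{-1}v}$, $\psi_t=\sum_{s=1}^t\|\widetilde x_s\|_{A_{s-1}^{-1}}$, and $$\beta(A,\delta,\lambda)=R\sqrt{\log\frac{\det(\lambda^{-1}A)}{\delta^2}}+\sqrt\lambda\,B .$$ In round $t+1$ ($0\le t<T$) the modified Thompson Sampling algorithm draws, conditionally on $x_1,y_1,\dots,x_t,y_t$, $$\mu_t\sim\mathcal N\bigl(\hat\theta_t,\ (\beta(A_t,\delta/2,\lambda)+\epsilon\psi_t)^2A_t^{-1}\bigr)$$ and selects $x_{t+1}\in\operatorname{argmax}_{x\in\mathcal A}\langle\mu_t,\widetilde x\rangle$ (ties broken arbitrarily). **Proposition.** There is a universal constant $c\in\mathbb N$, and for all $R\ge 0$, $B>0$, $\lambda\ge 1$ there is a constant $C>0$ depending only on $R,B,\lambda$, such that for every such problem (every $\mathcal A$, $D\ge1$, $T\ge 1$, $\epsilon\ge 0$, $\delta\in(0,1)$), with probability at least $1-\delta$ the algorithm satisfies $$R(T)\le C\,(1+\log T)^c\,\sqrt{\log|\mathcal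 A|}\,\Bigl\{D\sqrt T+\sqrt{DT\log(1/\delta)}+\log(1/\delta)\sqrt T+\bigl(DT+T\sqrt{D\log(1/\delta)}\bigr)\epsilon\Bigr\}.$$ -/

import Mathlib

open MeasureTheory ProbabilityTheory Matrix
open scoped BigOperators RealInnerProductSpace

namespace MisspecifiedBandit

/-! ### The misspecified linear model -/

/-- A misspecified linear reward model on the action set `𝒜` in dimension `D`: the mean reward is
`g a = ⟪θ, feat a⟫ + bias a`, where the feature map takes values in the Euclidean unit ball,
`‖θ‖ ≤ B`, `|g a| ≤ B` and `|bias a| ≤ ε` for every action. -/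
structure Model (𝒜 : Type*) (D : ℕ) (B ε : ℝ) where
  feat : 𝒜 → EuclideanSpace ℝ (Fin D)
  θ : EuclideanSpace ℝ (Fin D)
  bias : 𝒜 → ℝ
  norm_feat_le : ∀ a, ‖feat a‖ ≤ 1
  norm_θ_le : ‖θ‖ ≤ B
  abs_bias_le : ∀ a, |bias a| ≤ ε
  abs_mean_le : ∀ a, |⟪θ, feat a⟫ + bias a| ≤ B

/-- The mean reward `g`. -/
noncomputable def Model.mean {𝒜 : Type*} {D : ℕ} {B ε : ℝ} (M : Model 𝒜 D B ε) (a : 𝒜) : ℝ :=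
  ⟪M.θ, M.feat a⟫ + M.bias a

/-- The regret `∑_{t=1}^T (sup_a g a - g (x t))` of a sequence of actions. -/
noncomputable def Model.regret {𝒜 : Type*} {D : ℕ} {B ε : ℝ} (M : Model 𝒜 D B ε)
    (T : ℕ) (x : ℕ → 𝒜) : ℝ :=
  ∑ t ∈ Finset.Icc 1 T, ((⨆ a, M.mean a) - M.mean (x t))

/-! ### Statistics of the algorithm

Here `z s` is the feature vector of the action of round `s` and `y s` is the reward observed in
round `s`, for `s = 1, 2, …`. -/

section Statistics

variable {D : ℕ}

/-- `A_t = lam • 1 + ∑_{s=1}^t z_s z_sᵀ`. -/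
noncomputable def designMatrix (lam : ℝ) (z : ℕ → EuclideanSpace ℝ (Fin D)) (t : ℕ) :
    Matrix (Fin D) (Fin D) ℝ :=
  lam • (1 : Matrix (Fin D) (Fin D) ℝ) + ∑ s ∈ Finset.Icc 1 t, vecMulVec (z s) (z s)

/-- The regularised least squares estimate `A_t⁻¹ b_t`, where `b_t = ∑_{s=1}^t y_s z_s`. -/
noncomputable def leastSquares (lam : ℝ) (z : ℕ → EuclideanSpace ℝ (Fin D)) (y : ℕ → ℝ)
    (t : ℕ) : EuclideanSpace ℝ (Fin D) :=
  toEuclideanCLM (𝕜 := ℝ) (designMatrix lam z t)⁻¹ (∑ s ∈ Finset.Icc 1 t, y s • z s)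

/-- The norm `‖v‖_{A⁻¹} = √(vᵀ A⁻¹ v)`. -/
noncomputable def invNorm (A : Matrix (Fin D) (Fin D) ℝ) (v : EuclideanSpace ℝ (Fin D)) : ℝ :=
  √(v ⬝ᵥ A⁻¹ *ᵥ v)

/-- `β(A, δ, lam) = R √(log (det (lam⁻¹ A) / δ²)) + √lam B`. -/
noncomputable def confRadius (R B : ℝ) (A : Matrix (Fin D) (Fin D) ℝ) (δ lam : ℝ) : ℝ :=
  R * √(Real.log ((lam⁻¹ • A).det / δ ^ 2)) + √lam * B

/-- `ψ_t = ∑_{s=1}^t ‖z_s‖_{A_{s-1}⁻¹}`. -/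
noncomputable def cumWidth (lam : ℝ) (z : ℕ → EuclideanSpace ℝ (Fin D)) (t : ℕ) : ℝ :=
  ∑ s ∈ Finset.Icc 1 t, invNorm (designMatrix lam z (s - 1)) (z s)

/-- The law `N(θ̂_t, (β(A_t, δ/2, lam) + ε ψ_t)² A_t⁻¹)` from which the modified Thompson
Sampling algorithm samples in round `t + 1`. -/
noncomputable def samplingLaw (R B ε lam δ : ℝ) (z : ℕ → EuclideanSpace ℝ (Fin D)) (y : ℕ → ℝ)
    (t : ℕ) : Measure (EuclideanSpace ℝ (Fin D)) :=
  multivariateGaussian (leastSquares lam z y t)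
    ((confRadius R B (designMatrix lam z t) (δ / 2) lam + ε * cumWidth lam z t) ^ 2 •
      (designMatrix lam z t)⁻¹)

end Statistics

/-! ### The interaction -/

section Interaction

variable {Ω 𝒜 : Type*} [mΩ : MeasurableSpace Ω] [MeasurableSpace 𝒜]

/-- The σ-algebra generated by the actions and rewards of the rounds `1, …, t`. -/
abbrev history (x : ℕ → Ω → 𝒜) (y : ℕ → Ω → ℝ) (t : ℕ) : MeasurableSpace Ω :=
  ⨆ s ∈ Finset.Icc 1 t, MeasurableSpace.comap (x s) inferInstance ⊔
    MeasurableSpace.comap (y s) inferInstance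

/-- Actions `x t` and rewards `y t = g (x t) + η t`, for the rounds `t = 1, …, T`, such that `x t`
is `ℱ t`-measurable, `y t` is `ℱ (t + 1)`-measurable, and the noise `η` is conditionally
`R`-sub-Gaussian: `E[exp (ξ η_t) | ℱ_t] ≤ exp (ξ² R² / 2)` almost surely, for every real `ξ`. -/
structure IsInteraction {D : ℕ} {B ε : ℝ} (M : Model 𝒜 D B ε) (R : ℝ) (T : ℕ)
    (P : Measure Ω) (ℱ : Filtration ℕ mΩ) (x : ℕ → Ω → 𝒜) (y η : ℕ → Ω → ℝ) : Prop where
  action_measurable : ∀ t ∈ Finset.Icc 1 T, Measurable[ℱ t] (x t)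
  reward_measurable : ∀ t ∈ Finset.Icc 1 T, Measurable[ℱ (t + 1)] (y t)
  reward_eq : ∀ t ∈ Finset.Icc 1 T, ∀ ω, y t ω = M.mean (x t ω) + η t ω
  noise_integrable : ∀ t ∈ Finset.Icc 1 T, ∀ ξ : ℝ,
    Integrable (fun ω => Real.exp (ξ * η t ω)) P
  noise_subGaussian : ∀ t ∈ Finset.Icc 1 T, ∀ ξ : ℝ,
    P[fun ω => Real.exp (ξ * η t ω) | ℱ t] ≤ᵐ[P] fun _ => Real.exp (ξ ^ 2 * R ^ 2 / 2)

/-- The actions are chosen by the modified Thompson Sampling algorithm with parameters `lam` and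
`δ`: for `t = 0, …, T - 1`, the conditional law of `μ t` given the actions and rewards of the
rounds `1, …, t` is `samplingLaw`, and `x (t + 1)` maximises `a ↦ ⟪μ t, feat a⟫`
(ties may be broken in any way). -/
structure IsThompsonSampling {D : ℕ} {B ε : ℝ} (M : Model 𝒜 D B ε) (R lam δ : ℝ) (T : ℕ)
    (P : Measure Ω) (x : ℕ → Ω → 𝒜) (y : ℕ → Ω → ℝ)
    (μ : ℕ → Ω → EuclideanSpace ℝ (Fin D)) : Prop where
  sample_measurable : ∀ t < T, Measurable (μ t)
  sample_law : ∀ t < T, ∀ S : Set (EuclideanSpace ℝ (Fin D)), MeasurableSet S →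
    P⟦μ t ⁻¹' S | history x y t⟧ =ᵐ[P] fun ω =>
      (samplingLaw R B ε lam δ (fun s => M.feat (x s ω)) (fun s => y s ω) t).real S
  action_argmax : ∀ t < T, ∀ ω a, ⟪μ t ω, M.feat a⟫ ≤ ⟪μ t ω, M.feat (x (t + 1) ω)⟫

end Interaction

/-- The rate `√(log N) (D√T + √(D T log(1/δ)) + log(1/δ) √T + (D T + T √(D log(1/δ))) ε)`, where
`N` is the number of actions. -/
noncomputable def rate (N D T : ℕ) (ε δ : ℝ) : ℝ :=
  √(Real.log N) *
    (D * √T + √(D * T * Real.log (1 / δ)) + Real.log (1 / δ) * √T +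
      (D * T + T * √(D * Real.log (1 / δ))) * ε)

end MisspecifiedBandit

/-! # Regret of Thompson sampling for misspecified linear bandits

Write `v_t = β(A_t, δ/2, lam) + ε ψ_t` for the sampling scale and call `‖feat a‖_{A_t⁻¹}` the width
of the arm `a`. The proof combines four facts.

* *The estimates are accurate.* With probability `1 - δ/2`, for all `t` the least squares error in
  every direction `u` is at most `v_t ‖u‖_{A_t⁻¹}`
  (`IsInteraction.measure_exists_sampleScale_lt_le`). The noise enters through the process
  `selfNormalized`, which is a supermartingale: one step multiplies it by an average of
  `exp (ξ η - ξ² R² / 2)` over a one-dimensional Gaussian exponent `ξ`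
  (`lintegral_mul_selfNormalized_factor_le`), so that Ville's inequality applies. The bias costs
  `ε ψ_t` because `|uᵀ A_t⁻¹ z_s| ≤ ‖u‖_{A_t⁻¹} ‖z_s‖_{A_{s-1}⁻¹}`.

* *One round costs about `v_t` times the width of the selected arm.* A sample is optimistic for an
  optimal arm with at least the probability `p > 0` that a standard Gaussian exceeds `1`, and it is
  within `κ` standard deviations of its mean in the directions of all arms except with a small
  probability `q`. On the intersection of these events the selected arm is unsaturated, and the
  unsaturated arm of least width controls the regret of every accurate sample
  (`Model.exists_gap_le`). Hence the conditional mean of the regret is at most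
  `(1 + κ) (1 + 4 / p) v_t` times the conditional mean of the width, up to `2 B q + 2 ε`
  (`Model.integral_gap_sub_le`). Since ties may be broken in any way, the selected arm need
  not be a function of the history and the sample; the argument is therefore run under the regular
  conditional law of the pair (sample, arm), whose first marginal is the sampling law
  (`condExp_nonpos_of_law`).

* *Concentration.* The regret minus its bound, restricted to accurate histories, is a bounded
  supermartingale difference sequence for the history filtration, so the Azuma–Hoeffding inequality
  bounds its sum with probability `1 - δ/2`. Only here and in `v_t` does `log (1/δ)` appear, which
  keeps it out of the level
  `κ = √(2 log (2 m N T))`, where `N` is the number of arms and `m` a constant of order `1 / p`.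

* *The widths are summable.* The elliptical potential argument gives
  `∑ ‖z_s‖²_{A_{s-1}⁻¹} ≤ 2 D log (1 + T)` (`sum_sq_invNorm_le`), which bounds `ψ_T` and the sum of
  the widths of the selected arms by `√(2 D T log (1 + T))`.

The remaining inequality between the resulting expression and the rate is
`regret_bound_le_rate`. -/

/-! ### Rank-one updates of positive definite matrices -/

namespace Matrix.PosDef

variable {n : Type*} [Fintype n] {A : Matrix n n ℝ}

lemma add_vecMulVec_self (hA : A.PosDef) (z : n → ℝ) : (A + vecMulVec z z).PosDef :=
  hA.add_posSemidef (by simpa using posSemidef_vecMulVec_self_star z)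

variable [DecidableEq n]

lemma quadForm_inv_nonneg (hA : A.PosDef) (v : n → ℝ) : 0 ≤ v ⬝ᵥ A⁻¹ *ᵥ v := by
  simpa using hA.inv.posSemidef.dotProduct_mulVec_nonneg v

lemma dotProduct_inv_mulVec_comm (hA : A.PosDef) (u v : n → ℝ) :
    u ⬝ᵥ A⁻¹ *ᵥ v = v ⬝ᵥ A⁻¹ *ᵥ u := by
  have h : (A⁻¹)ᵀ = A⁻¹ := by simpa using hA.inv.isHermitian.eq
  rw [dotProduct_mulVec, ← mulVec_transpose, h, dotProduct_comm]

/-- Cauchy–Schwarz for the bilinear form of `A⁻¹`. -/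
lemma abs_dotProduct_inv_mulVec_le (hA : A.PosDef) (u v : n → ℝ) :
    |u ⬝ᵥ A⁻¹ *ᵥ v| ≤ √(u ⬝ᵥ A⁻¹ *ᵥ u) * √(v ⬝ᵥ A⁻¹ *ᵥ v) := by
  have h := fun s : ℝ => hA.quadForm_inv_nonneg (u + s • v)
  have hd := discrim_le_zero (a := v ⬝ᵥ A⁻¹ *ᵥ v) (b := 2 * (u ⬝ᵥ A⁻¹ *ᵥ v))
    (c := u ⬝ᵥ A⁻¹ *ᵥ u) fun s => by
      have := h s
      simp only [mulVec_add, mulVec_smul, add_dotProduct, dotProduct_add, smul_dotProduct,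
        dotProduct_smul, smul_eq_mul, hA.dotProduct_inv_mulVec_comm v u] at this
      linarith
  rw [← Real.sqrt_mul (hA.quadForm_inv_nonneg u)]
  apply Real.abs_le_sqrt
  rw [discrim] at hd
  linarith

/-- The Sherman–Morrison formula. -/
lemma inv_add_vecMulVec_self (hA : A.PosDef) (z : n → ℝ) :
    (A + vecMulVec z z)⁻¹ =
      A⁻¹ - (1 + z ⬝ᵥ A⁻¹ *ᵥ z)⁻¹ • vecMulVec (A⁻¹ *ᵥ z) (A⁻¹ *ᵥ z) := by
  have hw : 1 + z ⬝ᵥ A⁻¹ *ᵥ z ≠ 0 := by linarith [hA.quadForm_inv_nonneg z]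
  have hAA : A * A⁻¹ = 1 := mul_nonsing_inv _ hA.det_pos.ne'.isUnit
  have hs : vecMul z A⁻¹ = A⁻¹ *ᵥ z := by
    have h : (A⁻¹)ᵀ = A⁻¹ := by simpa using hA.inv.isHermitian.eq
    rw [← mulVec_transpose, h]
  apply inv_eq_right_inv
  simp only [add_mul, mul_sub, mul_smul_comm, mul_vecMulVec, mulVec_mulVec, hAA, one_mulVec,
    vecMulVec_mul, hs, vecMulVec_mulVec, dotProduct_comm (A⁻¹ *ᵥ z) z]
  ext i j
  simp only [add_apply, sub_apply, smul_apply, vecMulVec_apply, smul_eq_mul, Pi.smul_apply,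
    MulOpposite.smul_eq_mul_unop, MulOpposite.unop_op]
  field_simp
  ring

lemma dotProduct_inv_add_vecMulVec_self (hA : A.PosDef) (z u v : n → ℝ) :
    u ⬝ᵥ (A + vecMulVec z z)⁻¹ *ᵥ v = u ⬝ᵥ A⁻¹ *ᵥ v -
      (u ⬝ᵥ A⁻¹ *ᵥ z) * (z ⬝ᵥ A⁻¹ *ᵥ v) / (1 + z ⬝ᵥ A⁻¹ *ᵥ z) := by
  rw [hA.inv_add_vecMulVec_self, sub_mulVec, smul_mulVec, vecMulVec_mulVec, dotProduct_sub,
    dotProduct_smul, dotProduct_smul, hA.dotProduct_inv_mulVec_comm z v,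
    dotProduct_comm (A⁻¹ *ᵥ z) v]
  simp only [smul_eq_mul, MulOpposite.smul_eq_mul_unop, MulOpposite.unop_op]
  ring

/-- The matrix determinant lemma for a symmetric rank-one update. -/
lemma det_add_vecMulVec_self (hA : A.PosDef) (z : n → ℝ) :
    (A + vecMulVec z z).det = A.det * (1 + z ⬝ᵥ A⁻¹ *ᵥ z) := by
  rw [vecMulVec_eq Unit, det_add_replicateCol_mul_replicateRow hA.det_pos.ne'.isUnit]
  congr 1
  rw [Matrix.mul_assoc, ← replicateCol_mulVec, det_unique, add_apply, one_apply_eq,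
    replicateRow_mul_replicateCol_apply]

lemma quadForm_inv_add_vecMulVec_self_le (hA : A.PosDef) (z u : n → ℝ) :
    u ⬝ᵥ (A + vecMulVec z z)⁻¹ *ᵥ u ≤ u ⬝ᵥ A⁻¹ *ᵥ u := by
  rw [hA.dotProduct_inv_add_vecMulVec_self, hA.dotProduct_inv_mulVec_comm z u]
  have := hA.quadForm_inv_nonneg z
  have : 0 ≤ (u ⬝ᵥ A⁻¹ *ᵥ z) * (u ⬝ᵥ A⁻¹ *ᵥ z) / (1 + z ⬝ᵥ A⁻¹ *ᵥ z) :=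
    div_nonneg (mul_self_nonneg _) (by linarith)
  linarith

/-- How the form `S ↦ Sᵀ A⁻¹ S` changes when `S` moves along the direction of the rank-one
update. -/
lemma quadForm_inv_add_vecMulVec_self_add_smul (hA : A.PosDef) (z S : n → ℝ) (h : ℝ) :
    (S + h • z) ⬝ᵥ (A + vecMulVec z z)⁻¹ *ᵥ (S + h • z) = S ⬝ᵥ A⁻¹ *ᵥ S +
      (2 * h * (z ⬝ᵥ A⁻¹ *ᵥ S) + h ^ 2 * (z ⬝ᵥ A⁻¹ *ᵥ z) - (z ⬝ᵥ A⁻¹ *ᵥ S) ^ 2) /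
        (1 + z ⬝ᵥ A⁻¹ *ᵥ z) := by
  have hw : 1 + z ⬝ᵥ A⁻¹ *ᵥ z ≠ 0 := by linarith [hA.quadForm_inv_nonneg z]
  rw [hA.dotProduct_inv_add_vecMulVec_self]
  simp only [mulVec_add, mulVec_smul, add_dotProduct, dotProduct_add, smul_dotProduct,
        dotProduct_smul, smul_eq_mul, hA.dotProduct_inv_mulVec_comm S z]
  field_simp
  ring

end Matrix.PosDef

namespace MisspecifiedBandit

variable {D : ℕ} {lam : ℝ} {z : ℕ → EuclideanSpace ℝ (Fin D)}

/-! ### The design matrices -/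

@[simp]
lemma designMatrix_zero : designMatrix lam z 0 = lam • (1 : Matrix (Fin D) (Fin D) ℝ) := by
  simp [designMatrix]

lemma designMatrix_succ (t : ℕ) :
    designMatrix lam z (t + 1) = designMatrix lam z t + vecMulVec (z (t + 1)) (z (t + 1)) := by
  rw [designMatrix, Finset.sum_Icc_succ_top (by omega), ← add_assoc, designMatrix]

lemma posDef_designMatrix (hlam : 0 < lam) (t : ℕ) : (designMatrix lam z t).PosDef := by
  induction t with
  | zero => simpa using PosDef.one.smul hlam
  | succ t ih => rw [designMatrix_succ]; exact ih.add_vecMulVec_self _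

lemma invNorm_nonneg (A : Matrix (Fin D) (Fin D) ℝ) (v : EuclideanSpace ℝ (Fin D)) :
    0 ≤ invNorm A v := Real.sqrt_nonneg _

lemma invNorm_designMatrix_antitone (hlam : 0 < lam) (v : EuclideanSpace ℝ (Fin D)) :
    Antitone fun t => invNorm (designMatrix lam z t) v :=
  antitone_nat_of_succ_le fun t => Real.sqrt_le_sqrt <| by
    rw [designMatrix_succ]
    exact (posDef_designMatrix hlam t).quadForm_inv_add_vecMulVec_self_le _ _

lemma invNorm_designMatrix_zero (hlam : 0 < lam) (v : EuclideanSpace ℝ (Fin D)) :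
    invNorm (designMatrix lam z 0) v = ‖v‖ / √lam := by
  rw [invNorm, designMatrix_zero, show (lam • (1 : Matrix (Fin D) (Fin D) ℝ))⁻¹ = lam⁻¹ • 1 from
    inv_eq_right_inv (by simp [smul_smul, hlam.ne'])]
  rw [smul_mulVec, one_mulVec, dotProduct_smul, smul_eq_mul, inv_mul_eq_div,
    Real.sqrt_div' _ hlam.le, EuclideanSpace.norm_eq]
  simp [dotProduct, pow_two]

lemma invNorm_designMatrix_le (hlam : 0 < lam) (t : ℕ) (v : EuclideanSpace ℝ (Fin D)) :
    invNorm (designMatrix lam z t) v ≤ ‖v‖ / √lam :=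
  (invNorm_designMatrix_antitone hlam v t.zero_le).trans_eq (invNorm_designMatrix_zero hlam v)

lemma det_designMatrix_pos (hlam : 0 < lam) (t : ℕ) :
    0 < (lam⁻¹ • designMatrix lam z t).det :=
  ((posDef_designMatrix hlam t).smul (inv_pos.2 hlam)).det_pos

lemma det_designMatrix_succ (hlam : 0 < lam) (t : ℕ) :
    (lam⁻¹ • designMatrix lam z (t + 1)).det = (lam⁻¹ • designMatrix lam z t).det *
      (1 + invNorm (designMatrix lam z t) (z (t + 1)) ^ 2) := by
  have h := posDef_designMatrix (z := z) hlam t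
  rw [det_smul, det_smul, designMatrix_succ, h.det_add_vecMulVec_self, invNorm,
    Real.sq_sqrt (h.quadForm_inv_nonneg _), mul_assoc]

/-- The eigenvalues of `lam⁻¹ A_t` are at most `1 + t`, hence its determinant is at most
`(1 + t) ^ D`. -/
lemma log_det_designMatrix_le (hlam : 1 ≤ lam) (hz : ∀ s, ‖z s‖ ≤ 1) (t : ℕ) :
    Real.log (lam⁻¹ • designMatrix lam z t).det ≤ D * Real.log (1 + t) := by
  have hl : 0 < lam := by linarith
  have hA := (posDef_designMatrix (z := z) hl t).smul (inv_pos.2 hl)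
  have hinv : lam⁻¹ ≤ 1 := inv_le_one_of_one_le₀ hlam
  have heig : ∀ i, hA.isHermitian.eigenvalues i ≤ 1 + t := by
    intro i
    rw [hA.isHermitian.eigenvalues_eq]
    set u := hA.isHermitian.eigenvectorBasis i
    have hu : ‖u‖ = 1 := hA.isHermitian.eigenvectorBasis.norm_eq_one i
    have hin : ∀ v w : EuclideanSpace ℝ (Fin D), v.ofLp ⬝ᵥ w.ofLp = ⟪v, w⟫ := by
      intro v w; simp [PiLp.inner_apply, dotProduct, mul_comm]
    have hsmul : ∀ (c : ℝ) (v : Fin D → ℝ), MulOpposite.op c • v = c • v :=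
      fun c v => op_smul_eq_smul c v
    simp only [star_trivial, RCLike.re_to_real, designMatrix, smul_mulVec, add_mulVec, one_mulVec,
      sum_mulVec, vecMulVec_mulVec, hsmul, dotProduct_smul, dotProduct_add, dotProduct_sum,
      smul_eq_mul]
    simp only [hin, real_inner_self_eq_norm_sq, hu]
    have h1 : ∀ s ∈ Finset.Icc 1 t, ⟪z s, u⟫ * ⟪u, z s⟫ ≤ 1 := by
      intro s _
      rw [real_inner_comm u (z s), ← pow_two, sq_le_one_iff_abs_le_one]
      refine (abs_real_inner_le_norm _ _).trans ?_
      rw [hu]; linarith [hz s]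
    have h2 := Finset.sum_le_sum h1
    simp only [Finset.sum_const, Nat.card_Icc, Nat.add_sub_cancel, nsmul_eq_mul,
      mul_one] at h2
    have h3 : (0 : ℝ) ≤ t := t.cast_nonneg
    rw [mul_add, one_pow, mul_one, inv_mul_cancel₀ hl.ne']
    have h4 := mul_le_mul_of_nonneg_left h2 (inv_pos.2 hl).le
    nlinarith
  rw [hA.isHermitian.det_eq_prod_eigenvalues, RCLike.ofReal_real_eq_id]
  have hpos : ∀ i, 0 < hA.isHermitian.eigenvalues i := hA.eigenvalues_pos
  simp only [id]
  rw [Real.log_prod fun i _ => (hpos i).ne']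
  refine (Finset.sum_le_sum fun i _ => Real.log_le_log (hpos i) (heig i)).trans_eq ?_
  simp

/-- The elliptical potential bound `∑ ‖z_s‖²_{A_{s-1}⁻¹} ≤ 2 D log (1 + t)`. -/
lemma sum_sq_invNorm_le (hlam : 1 ≤ lam) (hz : ∀ s, ‖z s‖ ≤ 1) (t : ℕ) :
    ∑ s ∈ Finset.Icc 1 t, invNorm (designMatrix lam z (s - 1)) (z s) ^ 2 ≤
      2 * (D * Real.log (1 + t)) := by
  have hl : 0 < lam := by linarith
  refine le_trans ?_ (mul_le_mul_of_nonneg_left (log_det_designMatrix_le hlam hz t) zero_le_two)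
  induction t with
  | zero => simp [smul_smul, hl.ne']
  | succ t ih =>
    rw [Finset.sum_Icc_succ_top (by omega), Nat.add_sub_cancel, det_designMatrix_succ hl]
    set w := invNorm (designMatrix lam z t) (z (t + 1))
    have hw0 : 0 ≤ w := invNorm_nonneg _ _
    have hw1 : w ≤ 1 := by
      refine (invNorm_designMatrix_le hl t _).trans (div_le_one_of_le₀ ?_ (Real.sqrt_nonneg _))
      exact (hz _).trans (Real.one_le_sqrt.2 hlam)
    rw [Real.log_mul (det_designMatrix_pos hl t).ne' (by positivity)]
    -- `x ≤ 2 log (1 + x)` for `0 ≤ x ≤ 1`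
    have h : w ^ 2 / (1 + w ^ 2) ≤ Real.log (1 + w ^ 2) := by
      have := Real.one_sub_inv_le_log_of_pos (x := 1 + w ^ 2) (by positivity)
      convert this using 1
      field_simp
      ring
    have h' : w ^ 2 / 2 ≤ w ^ 2 / (1 + w ^ 2) :=
      div_le_div_of_nonneg_left (by positivity) (by positivity) (by nlinarith)
    linarith

lemma sum_invNorm_le (hlam : 1 ≤ lam) (hz : ∀ s, ‖z s‖ ≤ 1) (t : ℕ) :
    ∑ s ∈ Finset.Icc 1 t, invNorm (designMatrix lam z (s - 1)) (z s) ≤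
      √(2 * (t * (D * Real.log (1 + t)))) := by
  apply Real.le_sqrt_of_sq_le
  refine (sq_sum_le_card_mul_sum_sq).trans ?_
  have := mul_le_mul_of_nonneg_left (sum_sq_invNorm_le hlam hz t) (t.cast_nonneg (α := ℝ))
  simp only [Nat.card_Icc, Nat.add_sub_cancel]
  linarith

end MisspecifiedBandit

/-! ### Measurability of the statistics -/

section Measurability

variable {Ω n : Type*} {m : MeasurableSpace Ω} [Fintype n]

lemma measurable_dotProduct_mulVec {A : Ω → Matrix n n ℝ}
    (hA : ∀ i j, Measurable fun ω => A ω i j) {u v : Ω → n → ℝ}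
    (hu : ∀ i, Measurable fun ω => u ω i) (hv : ∀ i, Measurable fun ω => v ω i) :
    Measurable fun ω => u ω ⬝ᵥ A ω *ᵥ v ω := by
  simp only [dotProduct, mulVec]
  exact Finset.measurable_sum _ fun i _ => (hu i).mul <|
    Finset.measurable_sum _ fun j _ => (hA i j).mul (hv j)

variable [DecidableEq n]

lemma measurable_matrix_det {A : Ω → Matrix n n ℝ} (hA : ∀ i j, Measurable fun ω => A ω i j) :
    Measurable fun ω => (A ω).det := by
  simp only [det_apply]
  exact Finset.measurable_sum _ fun σ _ =>
    (Finset.measurable_prod _ fun i _ => hA _ _).const_smul _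

lemma measurable_matrix_inv {A : Ω → Matrix n n ℝ} (hA : ∀ i j, Measurable fun ω => A ω i j)
    (i j : n) : Measurable fun ω => (A ω)⁻¹ i j := by
  simp only [inv_def, Ring.inverse_eq_inv', Matrix.smul_apply, smul_eq_mul, adjugate_apply]
  refine (measurable_matrix_det hA).inv.mul (measurable_matrix_det fun k l => ?_)
  simp only [updateRow_apply]
  split_ifs
  · exact measurable_const
  · exact hA k l

end Measurability

namespace MisspecifiedBandit

variable {Ω : Type*} {m : MeasurableSpace Ω} {D t : ℕ} {lam R B δ : ℝ}
  {z : ℕ → Ω → EuclideanSpace ℝ (Fin D)} {y : ℕ → Ω → ℝ}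

lemma measurable_coord {v : Ω → EuclideanSpace ℝ (Fin D)} (hv : Measurable v) (i : Fin D) :
    Measurable fun ω => v ω i :=
  (EuclideanSpace.proj (𝕜 := ℝ) i).continuous.measurable.comp hv

lemma measurable_designMatrix (hz : ∀ s ∈ Finset.Icc 1 t, Measurable (z s)) (i j : Fin D) :
    Measurable fun ω => designMatrix lam (fun s => z s ω) t i j := by
  simp only [designMatrix, Matrix.add_apply, Matrix.sum_apply, vecMulVec_apply]
  exact measurable_const.add <| Finset.measurable_sum _ fun s hs =>
    (measurable_coord (hz s hs) i).mul (measurable_coord (hz s hs) j)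

lemma measurable_invNorm {A : Ω → Matrix (Fin D) (Fin D) ℝ}
    (hA : ∀ i j, Measurable fun ω => A ω i j) {v : Ω → EuclideanSpace ℝ (Fin D)}
    (hv : Measurable v) : Measurable fun ω => invNorm (A ω) (v ω) :=
  (measurable_dotProduct_mulVec (measurable_matrix_inv hA) (measurable_coord hv)
    (measurable_coord hv)).sqrt

lemma measurable_cumWidth (hz : ∀ s ∈ Finset.Icc 1 t, Measurable (z s)) :
    Measurable fun ω => cumWidth lam (fun s => z s ω) t := by
  refine Finset.measurable_sum _ fun s hs =>
    measurable_invNorm (measurable_designMatrix ?_) (hz s hs)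
  intro r hr
  simp only [Finset.mem_Icc] at hr hs
  exact hz r (Finset.mem_Icc.2 (by omega))

lemma measurable_det_designMatrix (hz : ∀ s ∈ Finset.Icc 1 t, Measurable (z s)) :
    Measurable fun ω => (lam⁻¹ • designMatrix lam (fun s => z s ω) t).det :=
  measurable_matrix_det fun i j => (measurable_designMatrix hz i j).const_smul lam⁻¹

lemma measurable_confRadius (hz : ∀ s ∈ Finset.Icc 1 t, Measurable (z s)) :
    Measurable fun ω => confRadius R B (designMatrix lam (fun s => z s ω) t) δ lam :=
  ((((measurable_det_designMatrix hz).div_const _).log.sqrt).const_mul R).add_const _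

lemma measurable_inner_leastSquares (hz : ∀ s ∈ Finset.Icc 1 t, Measurable (z s))
    (hy : ∀ s ∈ Finset.Icc 1 t, Measurable (y s)) (v : EuclideanSpace ℝ (Fin D)) :
    Measurable fun ω => ⟪leastSquares lam (fun s => z s ω) (fun s => y s ω) t, v⟫ := by
  simp only [real_inner_comm v, leastSquares, inner_toEuclideanCLM]
  refine measurable_dotProduct_mulVec (measurable_matrix_inv (measurable_designMatrix hz))
    (by simp) fun i => ?_
  simp only [WithLp.ofLp_sum, WithLp.ofLp_smul, Finset.sum_apply, Pi.smul_apply, smul_eq_mul]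
  exact Finset.measurable_sum _ fun s hs => (hy s hs).mul (measurable_coord (hz s hs) i)

end MisspecifiedBandit

/-! ### Exponential inequalities for conditionally sub-Gaussian noise -/

section SubGaussian

variable {Ω : Type*} {m mΩ : MeasurableSpace Ω} {P : Measure Ω} [IsProbabilityMeasure P]
  {R : ℝ} {h : Ω → ℝ}

/-- Pull-out of a nonnegative weight that is measurable for the conditioning σ-algebra and need not
be integrable. -/
lemma lintegral_mul_ofReal_le_of_condExp_le (hm : m ≤ mΩ) {f : Ω → ℝ} (hf0 : ∀ ω, 0 ≤ f ω)
    (hf : Integrable f P) {c : ℝ} (hc : P[f | m] ≤ᵐ[P] fun _ => c)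
    {W : Ω → ENNReal} (hW : Measurable[m] W) :
    ∫⁻ ω, W ω * ENNReal.ofReal (f ω) ∂P ≤ ∫⁻ ω, W ω * ENNReal.ofReal c ∂P := by
  have hfm : AEMeasurable (fun ω => ENNReal.ofReal (f ω)) P := hf.aemeasurable.ennreal_ofReal
  have hle : (P.withDensity fun ω => ENNReal.ofReal (f ω)).trim hm ≤
      (ENNReal.ofReal c • P).trim hm := by
    refine Measure.le_iff.2 fun s hs => ?_
    rw [trim_measurableSet_eq hm hs, trim_measurableSet_eq hm hs, withDensity_apply _ (hm s hs),
      ← ofReal_integral_eq_lintegral_ofReal hf.integrableOn (ae_of_all _ hf0),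
      ← setIntegral_condExp hm hf hs]
    have : ∫ ω in s, (P[f | m]) ω ∂P ≤ ∫ _ in s, c ∂P :=
      setIntegral_mono_ae integrable_condExp.integrableOn (integrable_const c).integrableOn hc
    refine (ENNReal.ofReal_le_ofReal this).trans ?_
    rw [setIntegral_const, smul_eq_mul, ENNReal.ofReal_mul measureReal_nonneg,
      ofReal_measureReal, Measure.smul_apply, smul_eq_mul, mul_comm]
  have hW' : Measurable W := hW.mono hm le_rfl
  calc ∫⁻ ω, W ω * ENNReal.ofReal (f ω) ∂P
      = ∫⁻ ω, W ω ∂(P.withDensity fun ω => ENNReal.ofReal (f ω)) := by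
        rw [lintegral_withDensity_eq_lintegral_mul₀ hfm hW'.aemeasurable]
        simp [mul_comm]
    _ = ∫⁻ ω, W ω ∂((P.withDensity fun ω => ENNReal.ofReal (f ω)).trim hm) :=
        (lintegral_trim hm hW).symm
    _ ≤ ∫⁻ ω, W ω ∂((ENNReal.ofReal c • P).trim hm) := lintegral_mono' hle le_rfl
    _ = ∫⁻ ω, W ω * ENNReal.ofReal c ∂P := by
        rw [lintegral_trim hm hW, lintegral_smul_measure, lintegral_mul_const _ hW', smul_eq_mul,
          mul_comm]

/-- A conditional sub-Gaussian bound at every fixed exponent extends to exponents that are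
measurable for the conditioning σ-algebra: simple functions first, then Fatou's lemma. -/
lemma lintegral_mul_exp_random_le (hm : m ≤ mΩ) (hh : Measurable h)
    (hint : ∀ ξ : ℝ, Integrable (fun ω => Real.exp (ξ * h ω)) P)
    (hsub : ∀ ξ : ℝ, P[fun ω => Real.exp (ξ * h ω) | m] ≤ᵐ[P]
      fun _ => Real.exp (ξ ^ 2 * R ^ 2 / 2))
    {ξ : Ω → ℝ} (hξ : Measurable[m] ξ) {W : Ω → ENNReal} (hW : Measurable[m] W) :
    ∫⁻ ω, W ω * ENNReal.ofReal (Real.exp (ξ ω * h ω - ξ ω ^ 2 * R ^ 2 / 2)) ∂P ≤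
      ∫⁻ ω, W ω ∂P := by
  have hW' : Measurable W := hW.mono hm le_rfl
  have hconst : ∀ c : ℝ, ∀ V : Ω → ENNReal, Measurable[m] V →
      ∫⁻ ω, V ω * ENNReal.ofReal (Real.exp (c * h ω - c ^ 2 * R ^ 2 / 2)) ∂P ≤ ∫⁻ ω, V ω ∂P := by
    intro c V hV
    have := lintegral_mul_ofReal_le_of_condExp_le hm (fun ω => (Real.exp_pos _).le) (hint c)
      (hsub c) ((measurable_mul_const (ENNReal.ofReal (Real.exp (-(c ^ 2 * R ^ 2 / 2))))).comp hV)
    simpa only [Function.comp_apply, mul_assoc, ← ENNReal.ofReal_mul (Real.exp_pos _).le,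
      ← Real.exp_add, neg_add_cancel, Real.exp_zero, ENNReal.ofReal_one, mul_one,
      neg_add_eq_sub] using this
  have hsimple : ∀ f : Ω → ℝ, Measurable[m] f → (Set.range f).Finite →
      ∫⁻ ω, W ω * ENNReal.ofReal (Real.exp (f ω * h ω - f ω ^ 2 * R ^ 2 / 2)) ∂P ≤
        ∫⁻ ω, W ω ∂P := by
    intro f hf hfin
    have hV : ∀ c, Measurable[m] ((f ⁻¹' {c}).indicator W) := fun c =>
      @Measurable.indicator _ _ (f ⁻¹' {c}) _ m _ _ hW (hf (measurableSet_singleton c))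
    have hsum : ∀ ω, W ω = ∑ c ∈ hfin.toFinset, (f ⁻¹' {c}).indicator W ω := by
      intro ω
      rw [Finset.sum_eq_single (f ω)]
      · simp
      · intro c _ hc
        exact Set.indicator_of_notMem (fun h' => hc (by simpa using h'.symm)) _
      · intro h'
        exact (h' (by simp)).elim
    calc ∫⁻ ω, W ω * ENNReal.ofReal (Real.exp (f ω * h ω - f ω ^ 2 * R ^ 2 / 2)) ∂P
        = ∫⁻ ω, ∑ c ∈ hfin.toFinset, (f ⁻¹' {c}).indicator W ω *
            ENNReal.ofReal (Real.exp (c * h ω - c ^ 2 * R ^ 2 / 2)) ∂P := by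
          refine lintegral_congr fun ω => ?_
          nth_rewrite 1 [hsum ω]
          rw [Finset.sum_mul]
          refine Finset.sum_congr rfl fun c _ => ?_
          by_cases hc : f ω = c
          · rw [hc]
          · rw [Set.indicator_of_notMem (by simpa using hc)]; simp
      _ = ∑ c ∈ hfin.toFinset, ∫⁻ ω, (f ⁻¹' {c}).indicator W ω *
            ENNReal.ofReal (Real.exp (c * h ω - c ^ 2 * R ^ 2 / 2)) ∂P :=
          lintegral_finsetSum _ fun c _ => ((hV c).mono hm le_rfl).mul (by fun_prop)
      _ ≤ ∑ c ∈ hfin.toFinset, ∫⁻ ω, (f ⁻¹' {c}).indicator W ω ∂P :=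
          Finset.sum_le_sum fun c _ => hconst c _ (hV c)
      _ = ∫⁻ ω, W ω ∂P := by
          rw [← lintegral_finsetSum _ fun c _ => (hV c).mono hm le_rfl]
          exact lintegral_congr fun ω => (hsum ω).symm
  have hξs : StronglyMeasurable[m] ξ := hξ.stronglyMeasurable
  obtain ⟨f, hfm, hfin, hf⟩ : ∃ f : ℕ → Ω → ℝ, (∀ k, Measurable[m] (f k)) ∧
      (∀ k, (Set.range (f k)).Finite) ∧
      ∀ ω, Filter.Tendsto (fun k => f k ω) Filter.atTop (nhds (ξ ω)) :=
    ⟨fun k => @SimpleFunc.toFun _ m _ (hξs.approx k),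
      fun k => @SimpleFunc.measurable _ _ m _ (hξs.approx k),
      fun k => @SimpleFunc.finite_range _ _ m (hξs.approx k), hξs.tendsto_approx⟩
  have hlim : ∀ ω, Filter.liminf (fun k => W ω * ENNReal.ofReal
      (Real.exp (f k ω * h ω - f k ω ^ 2 * R ^ 2 / 2))) Filter.atTop =
      W ω * ENNReal.ofReal (Real.exp (ξ ω * h ω - ξ ω ^ 2 * R ^ 2 / 2)) := by
    intro ω
    apply Filter.Tendsto.liminf_eq
    refine ENNReal.Tendsto.const_mul (ENNReal.tendsto_ofReal ?_) (Or.inl ?_)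
    · exact (Real.continuous_exp.tendsto _).comp
        (((hf ω).mul_const _).sub ((((hf ω).pow 2).mul_const _).div_const _))
    · simp [Real.exp_pos]
  simp only [← hlim]
  refine (lintegral_liminf_le fun k => hW'.mul ?_).trans ?_
  · have : Measurable (f k) := (hfm k).mono hm le_rfl
    fun_prop
  · exact Filter.liminf_le_of_le (by isBoundedDefault) fun b hb => by
      obtain ⟨k, hk⟩ := hb.exists
      exact hk.trans (hsimple (f k) (hfm k) (hfin k))

/-- Completing the square turns the integrand times the standard Gaussian density into a multiple of
the density of the Gaussian with mean `b / (1 + c)` and variance `1 / (1 + c)`. -/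
lemma lintegral_exp_quadratic_gaussianReal (b : ℝ) {c : ℝ} (hc : 0 ≤ c) :
    ∫⁻ g, ENNReal.ofReal (Real.exp (b * g - c * g ^ 2 / 2)) ∂(gaussianReal 0 1) =
      ENNReal.ofReal ((√(1 + c))⁻¹ * Real.exp (b ^ 2 / (2 * (1 + c)))) := by
  have h1 : 0 < 1 + c := by linarith
  let v : NNReal := ⟨(1 + c)⁻¹, by positivity⟩
  have hv : v ≠ 0 := by
    rw [← NNReal.coe_ne_zero]; exact (inv_pos.2 h1).ne'
  rw [gaussianReal_of_var_ne_zero _ one_ne_zero,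
    lintegral_withDensity_eq_lintegral_mul₀ (by fun_prop) (by fun_prop)]
  have hpt : ∀ g, (gaussianPDF 0 1 * fun g => ENNReal.ofReal (Real.exp (b * g - c * g ^ 2 / 2))) g =
      ENNReal.ofReal ((√(1 + c))⁻¹ * Real.exp (b ^ 2 / (2 * (1 + c)))) *
        gaussianPDF (b / (1 + c)) v g := by
    intro g
    rw [Pi.mul_apply, gaussianPDF, gaussianPDF, ← ENNReal.ofReal_mul (gaussianPDFReal_nonneg _ _ _),
      ← ENNReal.ofReal_mul (by positivity), gaussianPDFReal, gaussianPDFReal]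
    congr 1
    have hs : √(2 * Real.pi * (v : ℝ)) = √(2 * Real.pi) * (√(1 + c))⁻¹ := by
      rw [Real.sqrt_mul (by positivity), ← Real.sqrt_inv]; rfl
    have he : -(g - b / (1 + c)) ^ 2 / (2 * (v : ℝ)) =
        -(g - 0) ^ 2 / (2 * (1 : NNReal)) + (b * g - c * g ^ 2 / 2) - b ^ 2 / (2 * (1 + c)) := by
      change -(g - b / (1 + c)) ^ 2 / (2 * (1 + c)⁻¹) = _
      simp only [NNReal.coe_one]
      field_simp
      ring
    rw [hs, he, Real.exp_sub _ (b ^ 2 / _), Real.exp_add]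
    have : √(1 + c) ≠ 0 := (Real.sqrt_pos.2 h1).ne'
    simp only [NNReal.coe_one, mul_one]
    field_simp
  rw [lintegral_congr hpt, lintegral_const_mul _ (by fun_prop), lintegral_gaussianPDF_eq_one _ hv,
    mul_one]

/-- One step of the self-normalised supermartingale. The factor on the left is the average of
`exp (ξ h - ξ² R² / 2)` over a Gaussian exponent `ξ` with mean `u / R²` and variance `w / R²`. -/
lemma lintegral_mul_selfNormalized_factor_le (hR : 0 < R) (hm : m ≤ mΩ) (hh : Measurable h)
    (hint : ∀ ξ : ℝ, Integrable (fun ω => Real.exp (ξ * h ω)) P)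
    (hsub : ∀ ξ : ℝ, P[fun ω => Real.exp (ξ * h ω) | m] ≤ᵐ[P]
      fun _ => Real.exp (ξ ^ 2 * R ^ 2 / 2))
    {u w : Ω → ℝ} (hu : Measurable[m] u) (hw : Measurable[m] w) (hw0 : ∀ ω, 0 ≤ w ω)
    {W : Ω → ENNReal} (hW : Measurable[m] W) :
    ∫⁻ ω, W ω * ENNReal.ofReal ((√(1 + w ω))⁻¹ * Real.exp
      ((2 * h ω * u ω + h ω ^ 2 * w ω - u ω ^ 2) / (2 * R ^ 2 * (1 + w ω)))) ∂P ≤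
      ∫⁻ ω, W ω ∂P := by
  have hW' : Measurable W := hW.mono hm le_rfl
  have hu' : Measurable u := hu.mono hm le_rfl
  have hw' : Measurable w := hw.mono hm le_rfl
  let ξ : ℝ → Ω → ℝ := fun g ω => u ω / R ^ 2 + √(w ω) / R * g
  have hpt : ∀ ω, ENNReal.ofReal ((√(1 + w ω))⁻¹ * Real.exp
      ((2 * h ω * u ω + h ω ^ 2 * w ω - u ω ^ 2) / (2 * R ^ 2 * (1 + w ω)))) =
      ∫⁻ g, ENNReal.ofReal (Real.exp (ξ g ω * h ω - ξ g ω ^ 2 * R ^ 2 / 2))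
        ∂(gaussianReal 0 1) := by
    intro ω
    have h1 : 0 < 1 + w ω := by linarith [hw0 ω]
    have hsq : √(w ω) ^ 2 = w ω := Real.sq_sqrt (hw0 ω)
    have : ∀ g, ENNReal.ofReal (Real.exp (ξ g ω * h ω - ξ g ω ^ 2 * R ^ 2 / 2)) =
        ENNReal.ofReal (Real.exp ((2 * u ω * h ω - u ω ^ 2) / (2 * R ^ 2))) *
        ENNReal.ofReal (Real.exp ((√(w ω) / R * (h ω - u ω)) * g - w ω * g ^ 2 / 2)) := by
      intro g
      rw [← ENNReal.ofReal_mul (Real.exp_pos _).le, ← Real.exp_add]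
      congr 2
      simp only [ξ]
      have hws : w ω * g ^ 2 / 2 = √(w ω) ^ 2 * g ^ 2 / 2 := by rw [hsq]
      rw [hws]
      field_simp
      ring
    rw [lintegral_congr this, lintegral_const_mul _ (by fun_prop),
      lintegral_exp_quadratic_gaussianReal _ (hw0 ω), ← ENNReal.ofReal_mul (Real.exp_pos _).le,
      mul_left_comm, ← Real.exp_add]
    congr 3
    rw [mul_pow, div_pow, hsq]
    field_simp
    ring
  calc _ = ∫⁻ ω, ∫⁻ g, W ω * ENNReal.ofReal (Real.exp (ξ g ω * h ω - ξ g ω ^ 2 * R ^ 2 / 2))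
        ∂(gaussianReal 0 1) ∂P := by
        refine lintegral_congr fun ω => ?_
        rw [hpt, lintegral_const_mul _ (by fun_prop)]
    _ = ∫⁻ g, ∫⁻ ω, W ω * ENNReal.ofReal (Real.exp (ξ g ω * h ω - ξ g ω ^ 2 * R ^ 2 / 2))
        ∂P ∂(gaussianReal 0 1) := by
        refine lintegral_lintegral_swap (Measurable.aemeasurable ?_)
        simp only [Function.uncurry_def, ξ]
        fun_prop
    _ ≤ ∫⁻ _, ∫⁻ ω, W ω ∂P ∂(gaussianReal 0 1) := lintegral_mono fun g =>
        lintegral_mul_exp_random_le hm hh hint hsub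
          ((by fun_prop : Measurable fun p : ℝ × ℝ => p.1 / R ^ 2 + √p.2 / R * g).comp
            (hu.prodMk hw)) hW
    _ = ∫⁻ ω, W ω ∂P := by simp

/-- The noise vanishes almost surely when its sub-Gaussian constant is zero. -/
lemma ae_eq_zero_of_condExp_exp_le_one (hm : m ≤ mΩ)
    (hint : ∀ ξ : ℝ, Integrable (fun ω => Real.exp (ξ * h ω)) P)
    (hsub : ∀ ξ : ℝ, P[fun ω => Real.exp (ξ * h ω) | m] ≤ᵐ[P] fun _ => 1) :
    ∀ᵐ ω ∂P, h ω = 0 := by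
  have h1 : ∀ ξ : ℝ, ∫ ω, Real.exp (ξ * h ω) ∂P ≤ 1 := by
    intro ξ
    rw [← integral_condExp hm]
    exact (integral_mono_ae integrable_condExp (integrable_const 1) (hsub ξ)).trans (by simp)
  let f : Ω → ℝ := fun ω => Real.exp (1 * h ω) + Real.exp (-1 * h ω) - 2
  have hf : Integrable f P := ((hint 1).add (hint (-1))).sub (integrable_const 2)
  have hpos : ∀ x : ℝ, x ≠ 0 → 0 < Real.exp (1 * x) + Real.exp (-1 * x) - 2 := by
    intro x hx
    have h2 := Real.add_one_lt_exp (x := 1 * x) (by simpa using hx)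
    have h3 := Real.add_one_lt_exp (x := -1 * x) (by simpa using hx)
    linarith
  have hf0 : ∀ ω, 0 ≤ f ω := by
    intro ω
    by_cases hx : h ω = 0
    · simp [f, hx]; norm_num
    · exact (hpos _ hx).le
  have hzero : ∫ ω, f ω ∂P = 0 := by
    refine le_antisymm ?_ (integral_nonneg hf0)
    have h2 : ∫ ω, f ω ∂P = ∫ ω, Real.exp (1 * h ω) ∂P + ∫ ω, Real.exp (-1 * h ω) ∂P - 2 := by
      have := integral_sub ((hint 1).add (hint (-1))) (integrable_const (2 : ℝ))
      simpa only [Pi.add_apply, integral_add (hint 1) (hint (-1)), integral_const, probReal_univ,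
        one_smul] using this
    rw [h2]
    linarith [h1 1, h1 (-1)]
  filter_upwards [(integral_eq_zero_iff_of_nonneg hf0 hf).1 hzero] with ω hω
  by_contra hx
  exact (hpos _ hx).ne' hω

end SubGaussian

section Ville

variable {Ω : Type*} {mΩ : MeasurableSpace Ω} {P : Measure Ω}

/-- **Ville's maximal inequality** over a finite horizon for a nonnegative process that is a
supermartingale in the sense that its integrals over past events decrease. -/
lemma mul_measure_exists_le_of_supermartingale (ℱ : ℕ → MeasurableSpace Ω)
    (hℱ : Monotone ℱ) (hℱ' : ∀ t, ℱ t ≤ mΩ) {M : ℕ → Ω → ENNReal} {T : ℕ}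
    (hM : ∀ t ≤ T, Measurable[ℱ t] (M t)) (h0 : ∫⁻ ω, M 0 ω ∂P ≤ 1)
    (hstep : ∀ t < T, ∀ E, MeasurableSet[ℱ t] E → ∫⁻ ω in E, M (t + 1) ω ∂P ≤ ∫⁻ ω in E, M t ω ∂P)
    (c : ENNReal) : c * P {ω | ∃ t ≤ T, c ≤ M t ω} ≤ 1 := by
  let A : ℕ → Set Ω := fun t => {ω | ∃ s ≤ t, c ≤ M s ω}
  have hA : ∀ t ≤ T, MeasurableSet[ℱ t] (A t) := by
    intro t ht
    have : A t = ⋃ s ∈ Finset.Iic t, {ω | c ≤ M s ω} := by ext; simp [A]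
    rw [this]
    refine Finset.measurableSet_biUnion _ fun s hs => ?_
    have hs' := Finset.mem_Iic.1 hs
    exact hℱ hs' _ (hM s (hs'.trans ht) measurableSet_Ici)
  suffices H : ∀ t ≤ T, c * P (A t) + ∫⁻ ω in (A t)ᶜ, M t ω ∂P ≤ 1 from
    le_self_add.trans (H T le_rfl)
  intro t
  induction t with
  | zero =>
    intro ht
    refine le_trans ?_ h0
    have hm0 := hℱ' 0 _ (hA 0 ht)
    rw [← lintegral_add_compl (M 0) hm0 (μ := P)]
    gcongr ?_ + _
    rw [← setLIntegral_const]
    refine setLIntegral_mono' hm0 fun ω hω => ?_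
    obtain ⟨s, hs, h⟩ := hω
    rwa [Nat.le_zero.1 hs] at h
  | succ t ih =>
    intro ht
    refine le_trans ?_ (ih (by omega))
    have hm0 := hℱ' _ _ (hA t (by omega))
    have hm1 := hℱ' _ _ (hA (t + 1) ht)
    have hsub : A t ⊆ A (t + 1) := fun ω ⟨s, hs, h⟩ => ⟨s, hs.trans (Nat.le_succ t), h⟩
    have hsplit : P (A (t + 1)) = P (A t) + P (A (t + 1) \ A t) := by
      rw [← measure_union Set.disjoint_sdiff_right (hm1.diff hm0), Set.union_sdiff_cancel hsub]
    have hcompl : (A t)ᶜ = (A (t + 1) \ A t) ∪ (A (t + 1))ᶜ := by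
      ext ω
      have := @hsub ω
      simp only [Set.mem_compl_iff, Set.mem_union, Set.mem_sdiff]
      tauto
    rw [hsplit, mul_add, add_assoc]
    gcongr
    refine le_trans ?_ (hstep t (by omega) _ (hA t (by omega)).compl)
    rw [hcompl, lintegral_union hm1.compl
      (Set.disjoint_compl_right_iff_subset.2 Set.sdiff_subset)]
    gcongr
    rw [← setLIntegral_const]
    refine setLIntegral_mono' (hm1.diff hm0) fun ω hω => ?_
    obtain ⟨⟨s, hs, h⟩, hn⟩ := hω
    rcases hs.lt_or_eq with hlt | rfl
    · exact (hn ⟨s, Nat.lt_succ_iff.1 hlt, h⟩).elim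
    · exact h

end Ville

namespace MisspecifiedBandit

/-! ### The confidence ellipsoids -/

section Deterministic

variable {D : ℕ} {lam : ℝ} {z : ℕ → EuclideanSpace ℝ (Fin D)} {y h : ℕ → ℝ}

/-- The noise part `∑_{s=1}^t h_s z_s` of the vector `∑_{s=1}^t y_s z_s`. -/
noncomputable def noiseSum (z : ℕ → EuclideanSpace ℝ (Fin D)) (h : ℕ → ℝ) (t : ℕ) :
    EuclideanSpace ℝ (Fin D) :=
  ∑ s ∈ Finset.Icc 1 t, h s • z s

/-- The self-normalised process `det (lam⁻¹ A_t)^(-1/2) exp (‖S_t‖²_{A_t⁻¹} / (2 R²))`, where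
`S_t = noiseSum z h t`. -/
noncomputable def selfNormalized (R lam : ℝ) (z : ℕ → EuclideanSpace ℝ (Fin D)) (h : ℕ → ℝ)
    (t : ℕ) : ℝ :=
  (√(lam⁻¹ • designMatrix lam z t).det)⁻¹ *
    Real.exp (invNorm (designMatrix lam z t) (noiseSum z h t) ^ 2 / (2 * R ^ 2))

lemma invNorm_sq (hlam : 0 < lam) (t : ℕ) (v : EuclideanSpace ℝ (Fin D)) :
    invNorm (designMatrix lam z t) v ^ 2 = v ⬝ᵥ (designMatrix lam z t)⁻¹ *ᵥ v :=
  Real.sq_sqrt ((posDef_designMatrix hlam t).quadForm_inv_nonneg _)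

lemma noiseSum_succ (t : ℕ) :
    noiseSum z h (t + 1) = noiseSum z h t + h (t + 1) • z (t + 1) := by
  rw [noiseSum, Finset.sum_Icc_succ_top (by omega), noiseSum]

lemma selfNormalized_succ {R : ℝ} (hR : 0 < R) (hlam : 0 < lam) (t : ℕ) :
    selfNormalized R lam z h (t + 1) = selfNormalized R lam z h t *
      ((√(1 + z (t + 1) ⬝ᵥ (designMatrix lam z t)⁻¹ *ᵥ z (t + 1)))⁻¹ * Real.exp
        ((2 * h (t + 1) * (z (t + 1) ⬝ᵥ (designMatrix lam z t)⁻¹ *ᵥ noiseSum z h t) +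
          h (t + 1) ^ 2 * (z (t + 1) ⬝ᵥ (designMatrix lam z t)⁻¹ *ᵥ z (t + 1)) -
          (z (t + 1) ⬝ᵥ (designMatrix lam z t)⁻¹ *ᵥ noiseSum z h t) ^ 2) /
        (2 * R ^ 2 * (1 + z (t + 1) ⬝ᵥ (designMatrix lam z t)⁻¹ *ᵥ z (t + 1))))) := by
  have hA := posDef_designMatrix (z := z) hlam t
  have hw := hA.quadForm_inv_nonneg (z (t + 1))
  rw [selfNormalized, selfNormalized, invNorm_sq hlam, invNorm_sq hlam, det_designMatrix_succ hlam,
    invNorm_sq hlam, Real.sqrt_mul (det_designMatrix_pos hlam t).le, mul_inv, mul_mul_mul_comm,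
    ← Real.exp_add, noiseSum_succ, designMatrix_succ, WithLp.ofLp_add, WithLp.ofLp_smul,
    hA.quadForm_inv_add_vecMulVec_self_add_smul]
  congr 2
  have : 1 + z (t + 1) ⬝ᵥ (designMatrix lam z t)⁻¹ *ᵥ z (t + 1) ≠ 0 := by linarith
  field_simp

lemma inv_le_selfNormalized {R δ : ℝ} (hR : 0 < R) (hδ : 0 < δ) (hlam : 0 < lam) {t : ℕ}
    (ht : R * √(Real.log ((lam⁻¹ • designMatrix lam z t).det / δ ^ 2)) <
      invNorm (designMatrix lam z t) (noiseSum z h t)) :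
    δ⁻¹ ≤ selfNormalized R lam z h t := by
  rw [selfNormalized]
  set d := (lam⁻¹ • designMatrix lam z t).det
  set q := invNorm (designMatrix lam z t) (noiseSum z h t)
  have hd : 0 < d := det_designMatrix_pos hlam t
  have h1 : √(Real.log (d / δ ^ 2)) < q / R := by rwa [lt_div_iff₀ hR, mul_comm]
  have h2 : d / δ ^ 2 ≤ Real.exp ((q / R) ^ 2) := by
    rw [← Real.log_le_iff_le_exp (by positivity)]
    exact (Real.lt_sq_of_sqrt_lt h1).le
  have h3 : √d / δ ≤ Real.exp (q ^ 2 / (2 * R ^ 2)) := by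
    have h4 : √(d / δ ^ 2) = √d / δ := by rw [Real.sqrt_div hd.le, Real.sqrt_sq hδ.le]
    rw [← h4]
    refine Real.sqrt_le_iff.2 ⟨(Real.exp_pos _).le, h2.trans_eq ?_⟩
    rw [← Real.exp_nat_mul]
    congr 1
    push_cast
    field_simp
  have h5 : 0 < √d := Real.sqrt_pos.2 hd
  calc δ⁻¹ = (√d)⁻¹ * (√d / δ) := by field_simp
    _ ≤ _ := by gcongr

lemma abs_dotProduct_inv_designMatrix_le (hlam : 0 < lam) (t : ℕ)
    (u v : EuclideanSpace ℝ (Fin D)) :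
    |u ⬝ᵥ (designMatrix lam z t)⁻¹ *ᵥ v| ≤
      invNorm (designMatrix lam z t) u * invNorm (designMatrix lam z t) v :=
  (posDef_designMatrix hlam t).abs_dotProduct_inv_mulVec_le _ _

lemma inner_leastSquares_sub (hlam : 0 < lam) {t : ℕ} {θ : EuclideanSpace ℝ (Fin D)} {b : ℕ → ℝ}
    (hy : ∀ s ∈ Finset.Icc 1 t, y s = ⟪θ, z s⟫ + b s + h s) (v : EuclideanSpace ℝ (Fin D)) :
    ⟪leastSquares lam z y t - θ, v⟫ = v ⬝ᵥ (designMatrix lam z t)⁻¹ *ᵥ noiseSum z h t +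
      ∑ s ∈ Finset.Icc 1 t, b s * (v ⬝ᵥ (designMatrix lam z t)⁻¹ *ᵥ z s) -
      lam * (v ⬝ᵥ (designMatrix lam z t)⁻¹ *ᵥ θ) := by
  have hA := posDef_designMatrix (z := z) hlam t
  have hinv : (designMatrix lam z t)⁻¹ * designMatrix lam z t = 1 :=
    nonsing_inv_mul _ hA.det_pos.ne'.isUnit
  have hin : ∀ v w : EuclideanSpace ℝ (Fin D), ⟪v, w⟫ = v.ofLp ⬝ᵥ w.ofLp := by
    intro v w; simp [PiLp.inner_apply, dotProduct, mul_comm]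
  have hsmul : ∀ (c : ℝ) (v : Fin D → ℝ), MulOpposite.op c • v = c • v :=
    fun c v => op_smul_eq_smul c v
  have hAθ : designMatrix lam z t *ᵥ θ = lam • θ.ofLp +
      ∑ s ∈ Finset.Icc 1 t, ⟪θ, z s⟫ • (z s).ofLp := by
    simp only [designMatrix, add_mulVec, smul_mulVec, one_mulVec, sum_mulVec, vecMulVec_mulVec,
      hsmul, hin, dotProduct_comm θ.ofLp]
  have hsum : (∑ s ∈ Finset.Icc 1 t, y s • z s : EuclideanSpace ℝ (Fin D)).ofLp =
      designMatrix lam z t *ᵥ θ - lam • θ.ofLp + ∑ s ∈ Finset.Icc 1 t, b s • (z s).ofLp +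
        (noiseSum z h t).ofLp := by
    rw [hAθ, noiseSum, WithLp.ofLp_sum, WithLp.ofLp_sum, add_sub_cancel_left,
      ← Finset.sum_add_distrib, ← Finset.sum_add_distrib]
    refine Finset.sum_congr rfl fun s hs => ?_
    rw [hy s hs, WithLp.ofLp_smul, WithLp.ofLp_smul, add_smul, add_smul]
  rw [inner_sub_left, real_inner_comm v, leastSquares, inner_toEuclideanCLM, hsum, mulVec_add,
    mulVec_add, mulVec_sub, mulVec_mulVec, hinv, one_mulVec, mulVec_smul, mulVec_sum, hin θ v,
    dotProduct_comm θ.ofLp]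
  simp only [dotProduct_add, dotProduct_sub, dotProduct_smul, dotProduct_sum, mulVec_smul,
    smul_eq_mul]
  ring

/-- The least squares error in a direction `v`. The misspecification contributes
`ε ∑ |vᵀ A_t⁻¹ z_s| ≤ ε ψ_t ‖v‖_{A_t⁻¹}`. -/
lemma abs_inner_leastSquares_sub_le (hlam : 0 < lam) {t : ℕ} {θ : EuclideanSpace ℝ (Fin D)}
    {b : ℕ → ℝ} {B ε ρ : ℝ} (hε : 0 ≤ ε) (hθ : ‖θ‖ ≤ B) (hb : ∀ s, |b s| ≤ ε)
    (hy : ∀ s ∈ Finset.Icc 1 t, y s = ⟪θ, z s⟫ + b s + h s)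
    (hρ : invNorm (designMatrix lam z t) (noiseSum z h t) ≤ ρ) (v : EuclideanSpace ℝ (Fin D)) :
    |⟪leastSquares lam z y t - θ, v⟫| ≤
      (ρ + √lam * B + ε * cumWidth lam z t) * invNorm (designMatrix lam z t) v := by
  rw [inner_leastSquares_sub hlam hy]
  set A := designMatrix lam z t
  have hv := invNorm_nonneg A v
  have h1 : |v ⬝ᵥ A⁻¹ *ᵥ noiseSum z h t| ≤ invNorm A v * ρ :=
    (abs_dotProduct_inv_designMatrix_le hlam t v _).trans (mul_le_mul_of_nonneg_left hρ hv)
  have h2 : |∑ s ∈ Finset.Icc 1 t, b s * (v ⬝ᵥ A⁻¹ *ᵥ z s)| ≤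
      invNorm A v * (ε * cumWidth lam z t) := by
    refine (Finset.abs_sum_le_sum_abs _ _).trans ?_
    rw [cumWidth, Finset.mul_sum, Finset.mul_sum]
    refine Finset.sum_le_sum fun s hs => ?_
    rw [abs_mul, mul_left_comm]
    refine mul_le_mul (hb s) ?_ (abs_nonneg _) hε
    refine (abs_dotProduct_inv_designMatrix_le hlam t v _).trans
      (mul_le_mul_of_nonneg_left (invNorm_designMatrix_antitone hlam _ ?_) hv)
    have := (Finset.mem_Icc.1 hs).2
    omega
  have h3 : |lam * (v ⬝ᵥ A⁻¹ *ᵥ θ)| ≤ invNorm A v * (√lam * B) := by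
    have hs : √lam * √lam = lam := Real.mul_self_sqrt hlam.le
    have hs0 : 0 < √lam := Real.sqrt_pos.2 hlam
    rw [abs_mul, abs_of_pos hlam]
    calc lam * |v ⬝ᵥ A⁻¹ *ᵥ θ| ≤ lam * (invNorm A v * invNorm A θ) := by
          gcongr; exact abs_dotProduct_inv_designMatrix_le hlam t v _
      _ ≤ lam * (invNorm A v * (B / √lam)) := by
          gcongr
          exact (invNorm_designMatrix_le hlam t θ).trans (by gcongr)
      _ = invNorm A v * (√lam * B) := by
          nth_rewrite 1 [← hs]; field_simp
  calc _ ≤ |v ⬝ᵥ A⁻¹ *ᵥ noiseSum z h t| + |∑ s ∈ Finset.Icc 1 t, b s * (v ⬝ᵥ A⁻¹ *ᵥ z s)| +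
        |lam * (v ⬝ᵥ A⁻¹ *ᵥ θ)| := (abs_sub _ _).trans (by gcongr; exact abs_add_le _ _)
    _ ≤ invNorm A v * ρ + invNorm A v * (ε * cumWidth lam z t) + invNorm A v * (√lam * B) := by
        gcongr
    _ = _ := by ring

lemma measurable_noiseSum_coord {Ω : Type*} {m : MeasurableSpace Ω} {t : ℕ}
    {z : ℕ → Ω → EuclideanSpace ℝ (Fin D)} {h : ℕ → Ω → ℝ}
    (hz : ∀ s ∈ Finset.Icc 1 t, Measurable (z s))
    (hh : ∀ s ∈ Finset.Icc 1 t, Measurable (h s)) (i : Fin D) :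
    Measurable fun ω => noiseSum (fun s => z s ω) (fun s => h s ω) t i := by
  simp only [noiseSum, WithLp.ofLp_sum, WithLp.ofLp_smul, Finset.sum_apply, Pi.smul_apply,
    smul_eq_mul]
  exact Finset.measurable_sum _ fun s hs => (hh s hs).mul (measurable_coord (hz s hs) i)

end Deterministic

section Probabilistic

variable {Ω : Type*} [mΩ : MeasurableSpace Ω] {P : Measure Ω} [IsProbabilityMeasure P]
  {ℱ : Filtration ℕ mΩ} {D T : ℕ} {lam R : ℝ}
  {z : ℕ → Ω → EuclideanSpace ℝ (Fin D)} {h : ℕ → Ω → ℝ}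

/-- The self-normalised tail bound for vector-valued martingales, uniformly over time. -/
lemma measure_exists_lt_invNorm_noiseSum_le (hR : 0 < R) (hlam : 0 < lam) {δ : ℝ} (hδ : 0 < δ)
    (hz : ∀ t ∈ Finset.Icc 1 T, Measurable[ℱ t] (z t))
    (hh : ∀ t ∈ Finset.Icc 1 T, Measurable[ℱ (t + 1)] (h t))
    (hint : ∀ t ∈ Finset.Icc 1 T, ∀ ξ : ℝ, Integrable (fun ω => Real.exp (ξ * h t ω)) P)
    (hsub : ∀ t ∈ Finset.Icc 1 T, ∀ ξ : ℝ, P[fun ω => Real.exp (ξ * h t ω) | ℱ t] ≤ᵐ[P]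
      fun _ => Real.exp (ξ ^ 2 * R ^ 2 / 2)) :
    P {ω | ∃ t ≤ T, R * √(Real.log ((lam⁻¹ • designMatrix lam (fun s => z s ω) t).det / δ ^ 2)) <
      invNorm (designMatrix lam (fun s => z s ω) t)
        (noiseSum (fun s => z s ω) (fun s => h s ω) t)} ≤ ENNReal.ofReal δ := by
  let M : ℕ → Ω → ENNReal := fun t ω =>
    ENNReal.ofReal (selfNormalized R lam (fun s => z s ω) (fun s => h s ω) t)
  have hzF : ∀ t ≤ T, ∀ s ∈ Finset.Icc 1 t, Measurable[ℱ (t + 1)] (z s) := by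
    intro t ht s hs
    rw [Finset.mem_Icc] at hs
    exact (hz s (Finset.mem_Icc.2 ⟨hs.1, hs.2.trans ht⟩)).mono (ℱ.mono (by omega)) le_rfl
  have hhF : ∀ t ≤ T, ∀ s ∈ Finset.Icc 1 t, Measurable[ℱ (t + 1)] (h s) := by
    intro t ht s hs
    rw [Finset.mem_Icc] at hs
    exact (hh s (Finset.mem_Icc.2 ⟨hs.1, hs.2.trans ht⟩)).mono (ℱ.mono (by omega)) le_rfl
  have hSF : ∀ t ≤ T, ∀ i, Measurable[ℱ (t + 1)] fun ω =>
      noiseSum (fun s => z s ω) (fun s => h s ω) t i := fun t ht =>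
    measurable_noiseSum_coord (hzF t ht) (hhF t ht)
  have hAF : ∀ t ≤ T, ∀ i j, Measurable[ℱ (t + 1)] fun ω =>
      (designMatrix lam (fun s => z s ω) t)⁻¹ i j := fun t ht =>
    measurable_matrix_inv (measurable_designMatrix (hzF t ht))
  have hM : ∀ t ≤ T, Measurable[ℱ (t + 1)] (M t) := by
    intro t ht
    have h1 := measurable_det_designMatrix (lam := lam) (hzF t ht)
    have h2 := measurable_dotProduct_mulVec (hAF t ht) (hSF t ht) (hSF t ht)
    exact (by fun_prop : Measurable fun p : ℝ × ℝ =>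
      ENNReal.ofReal ((√p.1)⁻¹ * Real.exp ((√p.2) ^ 2 / (2 * R ^ 2)))).comp (h1.prodMk h2)
  have hville := mul_measure_exists_le_of_supermartingale (P := P) (fun t => ℱ (t + 1))
    (fun i j hij => ℱ.mono (by omega)) (fun t => ℱ.le _) (M := M) (T := T) hM ?_ ?_
    (ENNReal.ofReal δ⁻¹)
  · have hd : ENNReal.ofReal δ * ENNReal.ofReal δ⁻¹ = 1 := by
      rw [← ENNReal.ofReal_mul hδ.le, mul_inv_cancel₀ hδ.ne', ENNReal.ofReal_one]
    calc _ ≤ P {ω | ∃ t ≤ T, ENNReal.ofReal δ⁻¹ ≤ M t ω} :=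
          measure_mono fun ω hω => by
            obtain ⟨t, ht, hlt⟩ := hω
            exact ⟨t, ht, ENNReal.ofReal_le_ofReal (inv_le_selfNormalized hR hδ hlam hlt)⟩
      _ = ENNReal.ofReal δ * (ENNReal.ofReal δ⁻¹ *
            P {ω | ∃ t ≤ T, ENNReal.ofReal δ⁻¹ ≤ M t ω}) := by rw [← mul_assoc, hd, one_mul]
      _ ≤ ENNReal.ofReal δ * 1 := by gcongr
      _ = _ := mul_one _
  · simp [M, selfNormalized, noiseSum, invNorm, hlam.ne']
  · intro t ht E hE
    have hmem : t + 1 ∈ Finset.Icc 1 T := Finset.mem_Icc.2 ⟨by omega, ht⟩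
    have hE' := ℱ.le _ _ hE
    have hstep := lintegral_mul_selfNormalized_factor_le (P := P) hR (ℱ.le (t + 1))
      ((hh _ hmem).mono (ℱ.le _) le_rfl) (hint _ hmem) (hsub _ hmem)
      (measurable_dotProduct_mulVec (hAF t ht.le) (measurable_coord (hz _ hmem)) (hSF t ht.le))
      (measurable_dotProduct_mulVec (hAF t ht.le) (measurable_coord (hz _ hmem))
        (measurable_coord (hz _ hmem)))
      (fun ω => (posDef_designMatrix hlam t).quadForm_inv_nonneg _)
      (@Measurable.indicator _ _ E (M t) (ℱ (t + 1)) _ _ (hM t ht.le) hE)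
    rw [← lintegral_indicator hE', ← lintegral_indicator hE']
    refine le_trans (lintegral_mono fun ω => ?_) hstep
    by_cases hω : ω ∈ E
    · simp only [Set.indicator_of_mem hω, M]
      rw [selfNormalized_succ hR hlam, ENNReal.ofReal_mul]
      exact mul_nonneg (inv_nonneg.2 (Real.sqrt_nonneg _)) (Real.exp_pos _).le
    · simp [Set.indicator_of_notMem hω]

variable {𝒜 : Type*} [Fintype 𝒜] [MeasurableSpace 𝒜] [MeasurableSingletonClass 𝒜] {B ε : ℝ}
  {M : Model 𝒜 D B ε} {x : ℕ → Ω → 𝒜} {y η : ℕ → Ω → ℝ}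

/-- The standard deviation of the posterior samples, in units of the `A_t⁻¹`-norm. -/
noncomputable def sampleScale (R B ε lam δ : ℝ) (z : ℕ → EuclideanSpace ℝ (Fin D)) (t : ℕ) : ℝ :=
  confRadius R B (designMatrix lam z t) (δ / 2) lam + ε * cumWidth lam z t

/-- The true parameter lies in all confidence ellipsoids, up to an event of probability `δ / 2`. -/
lemma IsInteraction.measure_exists_sampleScale_lt_le (hI : IsInteraction M R T P ℱ x y η)
    (hR : 0 ≤ R) (hlam : 1 ≤ lam) (hε : 0 ≤ ε) {δ : ℝ} (hδ : 0 < δ) :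
    P {ω | ∃ t ≤ T, ∃ v, sampleScale R B ε lam δ (fun s => M.feat (x s ω)) t *
        invNorm (designMatrix lam (fun s => M.feat (x s ω)) t) v <
      |⟪leastSquares lam (fun s => M.feat (x s ω)) (fun s => y s ω) t - M.θ, v⟫|} ≤
      ENNReal.ofReal (δ / 2) := by
  have hl : 0 < lam := by linarith
  have key : ∀ ω, (∃ t ≤ T, ∃ v, sampleScale R B ε lam δ (fun s => M.feat (x s ω)) t *
        invNorm (designMatrix lam (fun s => M.feat (x s ω)) t) v <
      |⟪leastSquares lam (fun s => M.feat (x s ω)) (fun s => y s ω) t - M.θ, v⟫|) →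
      ∃ t ≤ T, R * √(Real.log ((lam⁻¹ • designMatrix lam (fun s => M.feat (x s ω)) t).det /
        (δ / 2) ^ 2)) < invNorm (designMatrix lam (fun s => M.feat (x s ω)) t)
        (noiseSum (fun s => M.feat (x s ω)) (fun s => η s ω) t) := by
    rintro ω ⟨t, ht, v, hv⟩
    refine ⟨t, ht, ?_⟩
    by_contra! hcon
    refine (lt_irrefl _ (hv.trans_le (abs_inner_leastSquares_sub_le hl hε M.norm_θ_le
      (fun s => M.abs_bias_le (x s ω)) (fun s hs => ?_) hcon v)))
    rw [Finset.mem_Icc] at hs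
    exact hI.reward_eq s (Finset.mem_Icc.2 ⟨hs.1, hs.2.trans ht⟩) ω
  have hmeas : ∀ t ∈ Finset.Icc 1 T, Measurable[ℱ (t + 1)] (η t) := by
    intro t ht
    have h1 : η t = fun ω => y t ω - M.mean (x t ω) := by
      ext ω; rw [hI.reward_eq t ht ω]; ring
    rw [h1]
    exact (hI.reward_measurable t ht).sub ((Measurable.of_discrete (f := M.mean)).comp
      ((hI.action_measurable t ht).mono (ℱ.mono t.le_succ) le_rfl))
  -- the supermartingale needs `R > 0`; for `R = 0` the noise vanishes almost surely
  rcases hR.eq_or_lt with rfl | hR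
  · refine (measure_mono_null (t := {ω | ∃ t ∈ Finset.Icc 1 T, η t ω ≠ 0}) ?_ ?_).trans_le
      zero_le
    · intro ω hω
      by_contra hcon
      simp only [Set.mem_ofPred_eq, not_exists, not_and, not_not] at hcon
      obtain ⟨t, ht, hlt⟩ := key ω hω
      have : noiseSum (fun s => M.feat (x s ω)) (fun s => η s ω) t = 0 :=
        Finset.sum_eq_zero fun s hs => by
          rw [Finset.mem_Icc] at hs
          simp only [hcon s (Finset.mem_Icc.2 ⟨hs.1, hs.2.trans ht⟩), zero_smul]
      simp [this, invNorm] at hlt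
    · have : {ω | ∃ t ∈ Finset.Icc 1 T, η t ω ≠ 0} =
          ⋃ t ∈ Finset.Icc 1 T, {ω | η t ω ≠ 0} := by ext; simp
      rw [this]
      refine (measure_biUnion_null_iff (Finset.Icc 1 T).countable_toSet).2 fun t ht => ?_
      exact ae_iff.1 (ae_eq_zero_of_condExp_exp_le_one (ℱ.le t) (hI.noise_integrable t ht)
        fun ξ => by simpa using hI.noise_subGaussian t ht ξ)
  · refine (measure_mono key).trans (measure_exists_lt_invNorm_noiseSum_le hR hl (half_pos hδ)
      (fun t ht => ?_) hmeas hI.noise_integrable hI.noise_subGaussian)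
    exact (Measurable.of_discrete (f := M.feat)).comp (hI.action_measurable t ht)

end Probabilistic

end MisspecifiedBandit

/-! ### One-dimensional marginals of the posterior samples -/

lemma gaussianReal_real_abs_gt_le {κ : ℝ} (hκ : 0 ≤ κ) :
    (gaussianReal 0 1).real {x | κ < |x|} ≤ 2 * Real.exp (-(κ ^ 2 / 2)) := by
  have hint : ∀ s : ℝ, Integrable (fun x => Real.exp (s * id x)) (gaussianReal 0 1) := fun s =>
    integrable_exp_mul_gaussianReal s
  have h1 := measure_ge_le_exp_mul_mgf (μ := gaussianReal 0 1) (X := id) κ hκ (hint κ)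
  have h2 := measure_le_le_exp_mul_mgf (μ := gaussianReal 0 1) (X := id) (-κ)
    (neg_nonpos.2 hκ) (hint (-κ))
  rw [mgf_id_gaussianReal] at h1 h2
  have hsub : {x : ℝ | κ < |x|} ⊆ {x | κ ≤ id x} ∪ {x | id x ≤ -κ} := by
    intro x hx
    rcases lt_abs.1 (show κ < |x| from hx) with h | h
    · exact Or.inl h.le
    · exact Or.inr (by simp only [Set.mem_ofPred_eq, id]; linarith)
  refine (measureReal_mono hsub).trans ((measureReal_union_le _ _).trans ?_)
  have h3 : Real.exp (-κ * κ) * Real.exp (0 * κ + (1 : NNReal) * κ ^ 2 / 2) =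
      Real.exp (-(κ ^ 2 / 2)) := by
    rw [← Real.exp_add]; congr 1; push_cast; ring
  have h4 : Real.exp (- -κ * -κ) * Real.exp (0 * -κ + (1 : NNReal) * (-κ) ^ 2 / 2) =
      Real.exp (-(κ ^ 2 / 2)) := by
    rw [← Real.exp_add]; congr 1; push_cast; ring
  simp only [h3] at h1
  simp only [h4] at h2
  linarith

lemma gaussianReal_real_Ici_pos (a : ℝ) : 0 < (gaussianReal 0 1).real (Set.Ici a) := by
  have hv : (1 : NNReal) ≠ 0 := one_ne_zero
  rw [measureReal_def, ENNReal.toReal_pos_iff]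
  refine ⟨pos_iff_ne_zero.2 fun h => ?_, measure_lt_top _ _⟩
  have := gaussianReal_absolutelyContinuous' 0 hv h
  simp at this

section Marginals

variable {D : ℕ} {A : Matrix (Fin D) (Fin D) ℝ} {m : EuclideanSpace ℝ (Fin D)} {σ : ℝ}

/-- The marginal in direction `v` of `N(m, σ² A⁻¹)`, centred, is `σ ‖v‖_{A⁻¹}` times a standard
Gaussian. -/
lemma map_inner_sub_multivariateGaussian (hA : A.PosDef) (v : EuclideanSpace ℝ (Fin D)) :
    (multivariateGaussian m (σ ^ 2 • A⁻¹)).map (fun e => ⟪e - m, v⟫) =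
      (gaussianReal 0 1).map (fun g => σ * MisspecifiedBandit.invNorm A v * g) := by
  have hS : (σ ^ 2 • A⁻¹).PosSemidef := hA.inv.posSemidef.smul (sq_nonneg σ)
  have hq : (σ * MisspecifiedBandit.invNorm A v) ^ 2 = v ⬝ᵥ (σ ^ 2 • A⁻¹) *ᵥ v := by
    rw [mul_pow, MisspecifiedBandit.invNorm, Real.sq_sqrt (hA.quadForm_inv_nonneg v), smul_mulVec,
      dotProduct_smul, smul_eq_mul]
  rw [gaussianReal_map_const_mul]
  have : IsProbabilityMeasure ((multivariateGaussian m (σ ^ 2 • A⁻¹)).map (fun e => ⟪e - m, v⟫)) :=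
    Measure.isProbabilityMeasure_map (by fun_prop)
  apply Measure.ext_of_charFun
  ext s
  rw [charFun_gaussianReal, charFun_apply_real, integral_map (by fun_prop) (by fun_prop)]
  have hpt : ∀ e : EuclideanSpace ℝ (Fin D), Complex.exp (s * (⟪e - m, v⟫ : ℝ) * Complex.I) =
      Complex.exp (-(⟪m, s • v⟫ : ℝ) * Complex.I) * Complex.exp ((⟪e, s • v⟫ : ℝ) * Complex.I) := by
    intro e
    rw [← Complex.exp_add, inner_sub_left, inner_smul_right, inner_smul_right]
    congr 1
    push_cast
    ring
  simp only [hpt]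
  rw [integral_const_mul, ← charFun_apply, charFun_multivariateGaussian hS, ← Complex.exp_add]
  congr 1
  have hq' : ((s • v).ofLp ⬝ᵥ (σ ^ 2 • A⁻¹) *ᵥ (s • v).ofLp) =
      (σ * MisspecifiedBandit.invNorm A v) ^ 2 * s ^ 2 := by
    rw [hq, WithLp.ofLp_smul, mulVec_smul, dotProduct_smul, smul_dotProduct]
    simp only [smul_eq_mul]; ring
  rw [real_inner_comm m]
  simp only [mul_zero, Complex.ofReal_zero, zero_mul, zero_sub]
  rw [hq', mul_one]
  change _ = -(((((σ * MisspecifiedBandit.invNorm A v) ^ 2 : ℝ)) : ℂ) * s ^ 2 / 2)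
  push_cast
  ring

lemma multivariateGaussian_real_ge (hA : A.PosDef) (hσ : 0 ≤ σ) (v : EuclideanSpace ℝ (Fin D)) :
    (gaussianReal 0 1).real (Set.Ici 1) ≤ (multivariateGaussian m (σ ^ 2 • A⁻¹)).real
      {e | σ * MisspecifiedBandit.invNorm A v ≤ ⟪e - m, v⟫} := by
  have hr : 0 ≤ σ * MisspecifiedBandit.invNorm A v :=
    mul_nonneg hσ (MisspecifiedBandit.invNorm_nonneg _ _)
  have h := map_measureReal_apply (μ := multivariateGaussian m (σ ^ 2 • A⁻¹))
    (f := fun e => ⟪e - m, v⟫) (by fun_prop)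
    (measurableSet_Ici (a := σ * MisspecifiedBandit.invNorm A v))
  rw [map_inner_sub_multivariateGaussian hA, map_measureReal_apply (by fun_prop)
    measurableSet_Ici] at h
  refine le_trans (measureReal_mono fun g hg => ?_) h.le
  exact le_mul_of_one_le_right hr hg

lemma multivariateGaussian_real_abs_gt_le (hA : A.PosDef) (hσ : 0 ≤ σ) {κ : ℝ} (hκ : 0 ≤ κ)
    (v : EuclideanSpace ℝ (Fin D)) :
    (multivariateGaussian m (σ ^ 2 • A⁻¹)).real
      {e | κ * (σ * MisspecifiedBandit.invNorm A v) < |⟪e - m, v⟫|} ≤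
      2 * Real.exp (-(κ ^ 2 / 2)) := by
  have hr : 0 ≤ σ * MisspecifiedBandit.invNorm A v :=
    mul_nonneg hσ (MisspecifiedBandit.invNorm_nonneg _ _)
  have hms : MeasurableSet {x : ℝ | κ * (σ * MisspecifiedBandit.invNorm A v) < |x|} :=
    measurableSet_lt measurable_const (by fun_prop)
  have h := map_measureReal_apply (μ := multivariateGaussian m (σ ^ 2 • A⁻¹))
    (f := fun e => ⟪e - m, v⟫) (by fun_prop) hms
  rw [map_inner_sub_multivariateGaussian hA, map_measureReal_apply (by fun_prop) hms] at h
  refine h.symm.le.trans ((measureReal_mono fun g hg => ?_).trans (gaussianReal_real_abs_gt_le hκ))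
  simp only [Set.mem_preimage, Set.mem_ofPred_eq, abs_mul, abs_of_nonneg hr] at hg ⊢
  by_contra! hcon
  nlinarith

end Marginals

/-! ### Regular conditional distributions -/

section Disintegration

variable {Ω E F : Type*} {m mΩ : MeasurableSpace Ω} [MeasurableSpace E] [MeasurableSpace F]

/-- If the conditional probabilities `P⟦Z ∈ S | X⟧` are given by `law · S`, for each `S`
separately, then `law` is almost surely the first marginal of the regular conditional distribution
of `(Z, Y)` given `X`. It suffices to compare them on a countable algebra of sets. -/
lemma ae_map_fst_condDistrib_eq {β : Type*} [MeasurableSpace β] [StandardBorelSpace E]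
    [StandardBorelSpace F] [Nonempty E] [Nonempty F] {P : Measure Ω} [IsProbabilityMeasure P]
    {X : Ω → β} (hX : Measurable X) {Z : Ω → E} {Y : Ω → F} (hZ : Measurable Z)
    (hY : Measurable Y) {law : Ω → Measure E} [∀ ω, IsProbabilityMeasure (law ω)]
    (hlaw : ∀ S, MeasurableSet S →
      P⟦Z ⁻¹' S | MeasurableSpace.comap X inferInstance⟧ =ᵐ[P] fun ω => (law ω).real S) :
    ∀ᵐ ω ∂P, (condDistrib (fun ω => (Z ω, Y ω)) X P (X ω)).map Prod.fst = law ω := by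
  let C : Set (Set E) := generateSetAlgebra (MeasurableSpace.countableGeneratingSet E)
  have hC : C.Countable :=
    countable_generateSetAlgebra (MeasurableSpace.countable_countableGeneratingSet)
  have hgen : ‹MeasurableSpace E› = MeasurableSpace.generateFrom C := by
    rw [generateFrom_generateSetAlgebra_eq, MeasurableSpace.generateFrom_countableGeneratingSet]
  have hpi : IsPiSystem C := isSetAlgebra_generateSetAlgebra.isSetRing.isSetSemiring.isPiSystem
  have hCm : ∀ S ∈ C, MeasurableSet S := by
    intro S hS
    have h := MeasurableSpace.measurableSet_generateFrom hS
    rwa [← hgen] at h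
  have hall : ∀ᵐ ω ∂P, ∀ S ∈ C,
      (condDistrib (fun ω => (Z ω, Y ω)) X P (X ω)).real (Prod.fst ⁻¹' S) = (law ω).real S := by
    rw [ae_ball_iff hC]
    intro S hS
    have h1 := condDistrib_ae_eq_condExp (μ := P) hX (hZ.prodMk hY) (measurable_fst (hCm S hS))
    filter_upwards [h1, hlaw S (hCm S hS)] with ω h2 h3
    rw [h2, ← h3]
    rfl
  filter_upwards [hall] with ω hω
  have : IsProbabilityMeasure ((condDistrib (fun ω => (Z ω, Y ω)) X P (X ω)).map Prod.fst) :=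
    Measure.isProbabilityMeasure_map measurable_fst.aemeasurable
  refine ext_of_generate_finite C hgen hpi (fun S hS => ?_) (by simp)
  rw [Measure.map_apply measurable_fst (hCm S hS)]
  have := hω S hS
  rwa [measureReal_def, measureReal_def, ENNReal.toReal_eq_toReal_iff' (by finiteness)
    (by finiteness)] at this

end Disintegration

/-! ### Martingale concentration -/

section Azuma

variable {Ω : Type*} {mΩ : MeasurableSpace Ω} {P : Measure Ω} [IsProbabilityMeasure P]

/-- On `[-c, c]` the graph of `x ↦ exp (s x)` lies below its chord. -/
lemma Real.exp_mul_le_cosh_add_sinh {s c x : ℝ} (hc : 0 < c) (hx : |x| ≤ c) :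
    Real.exp (s * x) ≤ Real.cosh (s * c) + x / c * Real.sinh (s * c) := by
  obtain ⟨h1, h2⟩ := abs_le.1 hx
  have h3 : -1 ≤ x / c := by rw [le_div_iff₀ hc]; linarith
  have h4 : x / c ≤ 1 := by rw [div_le_iff₀ hc]; linarith
  have h := convexOn_exp.2 (Set.mem_univ (s * c)) (Set.mem_univ (-(s * c)))
    (show 0 ≤ (1 + x / c) / 2 by linarith) (show 0 ≤ (1 - x / c) / 2 by linarith) (by ring)
  simp only [smul_eq_mul] at h
  rw [show (1 + x / c) / 2 * (s * c) + (1 - x / c) / 2 * -(s * c) = s * x by field_simp; ring] at h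
  refine h.trans_eq ?_
  rw [Real.cosh_eq, Real.sinh_eq]
  ring

/-- **Hoeffding's lemma** for a conditional expectation: a bounded random variable with
nonpositive conditional mean is conditionally sub-Gaussian on one side. -/
lemma condExp_exp_mul_le {m : MeasurableSpace Ω} (hm : m ≤ mΩ) {X : Ω → ℝ} (hX : Measurable[mΩ] X)
    {c s : ℝ} (hc : 0 < c) (hs : 0 ≤ s) (hb : ∀ ω, |X ω| ≤ c) (hmean : P[X | m] ≤ᵐ[P] 0) :
    P[fun ω => Real.exp (s * X ω) | m] ≤ᵐ[P] fun _ => Real.exp (s ^ 2 * c ^ 2 / 2) := by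
  have hXi : Integrable X P := Integrable.of_bound hX.aestronglyMeasurable c (ae_of_all _ hb)
  have hei : Integrable (fun ω => Real.exp (s * X ω)) P := by
    refine Integrable.of_bound (by fun_prop) (Real.exp (s * c)) (ae_of_all _ fun ω => ?_)
    rw [Real.norm_eq_abs, Real.abs_exp]
    exact Real.exp_le_exp.2 (mul_le_mul_of_nonneg_left (abs_le.1 (hb ω)).2 hs)
  let k : ℝ := Real.sinh (s * c) / c
  have hk : 0 ≤ k := div_nonneg (Real.sinh_nonneg_iff.2 (by positivity)) hc.le
  have h1 : P[fun ω => Real.exp (s * X ω) | m] ≤ᵐ[P]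
      P[(fun _ => Real.cosh (s * c)) + k • X | m] := by
    refine condExp_mono hei ((integrable_const _).add (hXi.smul k)) (ae_of_all _ fun ω => ?_)
    refine (Real.exp_mul_le_cosh_add_sinh hc (hb ω)).trans_eq ?_
    simp only [Pi.add_apply, Pi.smul_apply, smul_eq_mul, k]
    ring
  have h2 := condExp_add (μ := P) (m := m) (integrable_const (Real.cosh (s * c))) (hXi.smul k)
  have h3 := condExp_smul (μ := P) (m := m) k X
  filter_upwards [h1, h2, h3, hmean] with ω h1 h2 h3 h4
  rw [h2] at h1
  refine h1.trans ?_
  rw [Pi.add_apply, h3, condExp_const hm, Pi.smul_apply, smul_eq_mul]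
  have h5 : k * (P[X | m]) ω ≤ 0 := mul_nonpos_of_nonneg_of_nonpos hk h4
  have h6 := Real.cosh_le_exp_half_sq (s * c)
  rw [mul_pow] at h6
  linarith

/-- **The Azuma–Hoeffding inequality** for the sums of a bounded supermartingale difference
sequence `X 1, …, X T`. -/
lemma measure_le_sum_le_of_condExp_nonpos (ℱ : ℕ → MeasurableSpace Ω) {T : ℕ}
    (hmono : ∀ s t, s ≤ t → t ≤ T → ℱ s ≤ ℱ t) (hle : ∀ t ≤ T, ℱ t ≤ mΩ) {X : ℕ → Ω → ℝ}
    (hX : ∀ t < T, Measurable[ℱ (t + 1)] (X (t + 1))) {c s : ℝ} (hc : 0 < c) (hs : 0 ≤ s)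
    (hb : ∀ t < T, ∀ ω, |X (t + 1) ω| ≤ c) (hmean : ∀ t < T, P[X (t + 1) | ℱ t] ≤ᵐ[P] 0) (u : ℝ) :
    P {ω | u ≤ ∑ t ∈ Finset.Icc 1 T, X t ω} ≤
      ENNReal.ofReal (Real.exp (T * (s ^ 2 * c ^ 2 / 2) - s * u)) := by
  have hsum : ∀ t ≤ T, Measurable[ℱ t] fun ω => ∑ r ∈ Finset.Icc 1 t, X r ω := by
    intro t ht
    refine Finset.measurable_sum _ fun r hr => ?_
    obtain ⟨h1, h2⟩ := Finset.mem_Icc.1 hr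
    obtain ⟨r, rfl⟩ : ∃ k, r = k + 1 := ⟨r - 1, by omega⟩
    exact (hX r (by omega)).mono (hmono _ _ h2 ht) le_rfl
  have hmgf : ∀ t ≤ T, ∫⁻ ω, ENNReal.ofReal (Real.exp (s * ∑ r ∈ Finset.Icc 1 t, X r ω)) ∂P ≤
      ENNReal.ofReal (Real.exp (t * (s ^ 2 * c ^ 2 / 2))) := by
    intro t
    induction t with
    | zero => simp
    | succ t ih =>
      intro ht
      have hXt : Measurable (X (t + 1)) := (hX t ht).mono (hle _ ht) le_rfl
      have hei : Integrable (fun ω => Real.exp (s * X (t + 1) ω)) P := by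
        refine Integrable.of_bound (by fun_prop) (Real.exp (s * c)) (ae_of_all _ fun ω => ?_)
        rw [Real.norm_eq_abs, Real.abs_exp]
        exact Real.exp_le_exp.2 (mul_le_mul_of_nonneg_left (abs_le.1 (hb t ht ω)).2 hs)
      have hW : Measurable[ℱ t] fun ω =>
          ENNReal.ofReal (Real.exp (s * ∑ r ∈ Finset.Icc 1 t, X r ω)) :=
        (by fun_prop : Measurable fun a : ℝ => ENNReal.ofReal (Real.exp (s * a))).comp
          (hsum t (by omega))
      have h := lintegral_mul_ofReal_le_of_condExp_le (hle t (by omega))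
        (fun ω => (Real.exp_pos _).le) hei
        (condExp_exp_mul_le (hle t (by omega)) hXt hc hs (hb t ht) (hmean t ht)) hW
      rw [lintegral_mul_const _ (hW.mono (hle t (by omega)) le_rfl)] at h
      calc _ = ∫⁻ ω, ENNReal.ofReal (Real.exp (s * ∑ r ∈ Finset.Icc 1 t, X r ω)) *
            ENNReal.ofReal (Real.exp (s * X (t + 1) ω)) ∂P := by
            refine lintegral_congr fun ω => ?_
            rw [Finset.sum_Icc_succ_top (by omega), mul_add, Real.exp_add,
              ENNReal.ofReal_mul (Real.exp_pos _).le]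
        _ ≤ _ := h
        _ ≤ ENNReal.ofReal (Real.exp (t * (s ^ 2 * c ^ 2 / 2))) *
            ENNReal.ofReal (Real.exp (s ^ 2 * c ^ 2 / 2)) := by gcongr; exact ih (by omega)
        _ = _ := by
            rw [← ENNReal.ofReal_mul (Real.exp_pos _).le, ← Real.exp_add]
            congr 2
            push_cast
            ring
  have hmarkov := mul_meas_ge_le_lintegral (μ := P)
    (f := fun ω => ENNReal.ofReal (Real.exp (s * ∑ r ∈ Finset.Icc 1 T, X r ω)))
    (((by fun_prop : Measurable fun a : ℝ => ENNReal.ofReal (Real.exp (s * a))).comp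
      (hsum T le_rfl)).mono (hle T le_rfl) le_rfl) (ENNReal.ofReal (Real.exp (s * u)))
  have hone : ENNReal.ofReal (Real.exp (-(s * u))) * ENNReal.ofReal (Real.exp (s * u)) = 1 := by
    rw [← ENNReal.ofReal_mul (Real.exp_pos _).le, ← Real.exp_add]
    simp
  calc P {ω | u ≤ ∑ t ∈ Finset.Icc 1 T, X t ω}
      ≤ P {ω | ENNReal.ofReal (Real.exp (s * u)) ≤
          ENNReal.ofReal (Real.exp (s * ∑ r ∈ Finset.Icc 1 T, X r ω))} :=
        measure_mono fun ω hω => ENNReal.ofReal_le_ofReal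
          (Real.exp_le_exp.2 (mul_le_mul_of_nonneg_left hω hs))
    _ = ENNReal.ofReal (Real.exp (-(s * u))) * (ENNReal.ofReal (Real.exp (s * u)) *
          P {ω | ENNReal.ofReal (Real.exp (s * u)) ≤
          ENNReal.ofReal (Real.exp (s * ∑ r ∈ Finset.Icc 1 T, X r ω))}) := by
        rw [← mul_assoc, hone, one_mul]
    _ ≤ ENNReal.ofReal (Real.exp (-(s * u))) *
          ENNReal.ofReal (Real.exp (T * (s ^ 2 * c ^ 2 / 2))) := by
        gcongr
        exact hmarkov.trans (hmgf T le_rfl)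
    _ = _ := by
        rw [← ENNReal.ofReal_mul (Real.exp_pos _).le, ← Real.exp_add]
        congr 2
        ring

end Azuma

/-! ### Conditional regret of one round -/

section ConditionalMean

variable {Ω E F β : Type*} {mΩ : MeasurableSpace Ω} [MeasurableSpace E] [MeasurableSpace F]
  [MeasurableSpace β] [StandardBorelSpace E] [StandardBorelSpace F] [Nonempty E] [Nonempty F]
  {P : Measure Ω} [IsProbabilityMeasure P]

/-- A conditional mean given `X` of a function of `(X, Y)` is nonpositive as soon as the
corresponding mean is nonpositive under every joint law `K` of `(Z, Y)` that has the prescribed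
first marginal and is supported in `H`. -/
lemma condExp_nonpos_of_law {X : Ω → β} (hX : Measurable X) {Z : Ω → E} {Y : Ω → F}
    (hZ : Measurable Z) (hY : Measurable Y) {law : Ω → Measure E}
    [∀ ω, IsProbabilityMeasure (law ω)]
    (hlaw : ∀ S, MeasurableSet S →
      P⟦Z ⁻¹' S | MeasurableSpace.comap X inferInstance⟧ =ᵐ[P] fun ω => (law ω).real S)
    {H : Set (E × F)} (hH : MeasurableSet H) (hZY : ∀ ω, (Z ω, Y ω) ∈ H)
    {f : β × F → ℝ} (hf : Measurable f) {c : ℝ} (hc : ∀ ω, |f (X ω, Y ω)| ≤ c)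
    (hmean : ∀ ω, ∀ K : Measure (E × F), IsProbabilityMeasure K → K.map Prod.fst = law ω →
      (∀ᵐ e ∂K, e ∈ H) → ∫ e, f (X ω, e.2) ∂K ≤ 0) :
    P[fun ω => f (X ω, Y ω) | MeasurableSpace.comap X inferInstance] ≤ᵐ[P] 0 := by
  have h1 := ae_map_fst_condDistrib_eq hX hZ hY hlaw
  have h2 := condDistrib_ae_eq_condExp (μ := P) hX (hZ.prodMk hY) hH
  have h3 := condExp_prod_ae_eq_integral_condDistrib (μ := P) hX (hZ.prodMk hY).aemeasurable
    (f := fun p : β × (E × F) => f (p.1, p.2.2))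
    (by fun_prop : Measurable fun p : β × (E × F) => f (p.1, p.2.2)).stronglyMeasurable
    (Integrable.of_bound (hf.comp (hX.prodMk hY)).aestronglyMeasurable c (ae_of_all _ hc))
  have huniv : (fun ω => (Z ω, Y ω)) ⁻¹' H = Set.univ := Set.eq_univ_of_forall hZY
  rw [huniv, Set.indicator_univ, condExp_const hX.comap_le] at h2
  filter_upwards [h1, h2, h3] with ω h1 h2 h3
  rw [h3]
  refine hmean ω _ inferInstance h1 ?_
  exact (mem_ae_iff_prob_eq_one hH).2 ((ENNReal.toReal_eq_one_iff _).1 h2)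

end ConditionalMean

namespace MisspecifiedBandit

section OneStep

lemma Model.nonneg_bound {𝒜 : Type*} {D : ℕ} {B ε : ℝ} (M : Model 𝒜 D B ε) : 0 ≤ B :=
  (norm_nonneg _).trans M.norm_θ_le

variable {𝒜 : Type*} {D : ℕ} {B ε : ℝ} (M : Model 𝒜 D B ε)

lemma Model.exists_mean_eq_iSup [Finite 𝒜] [Nonempty 𝒜] : ∃ a, M.mean a = ⨆ b, M.mean b :=
  exists_eq_ciSup_of_finite

lemma Model.gap_nonneg [Finite 𝒜] (a : 𝒜) : 0 ≤ (⨆ b, M.mean b) - M.mean a :=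
  sub_nonneg.2 (le_ciSup (Set.finite_range _).bddAbove a)

lemma Model.gap_le [Finite 𝒜] [Nonempty 𝒜] (a : 𝒜) : (⨆ b, M.mean b) - M.mean a ≤ 2 * B := by
  obtain ⟨s, hs⟩ := M.exists_mean_eq_iSup
  rw [← hs]
  have h1 := abs_le.1 (M.abs_mean_le s)
  have h2 := abs_le.1 (M.abs_mean_le a)
  simp only [Model.mean]
  linarith [h1.2, h2.1]

variable [Fintype 𝒜] [Nonempty 𝒜]
  {A : Matrix (Fin D) (Fin D) ℝ} {m : EuclideanSpace ℝ (Fin D)} {σ κ q p : ℝ}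

open Classical in
/-- The pointwise comparison behind the one-round regret bound. Call an arm unsaturated if its
linear gap to the arm `s` is at most `(1 + κ) σ` times its width, and let `w` be the smallest width
of an unsaturated arm. If the sample `e` is within `κ` standard deviations of its mean in the
directions of all arms, the regret of the arm it selects is controlled by `w` and by the width of
that arm. If moreover the sample exceeds its mean by one standard deviation in the direction of `s`,
the selected arm is itself unsaturated, so that its width is at least `w`. The last two summands of
the bound collect the terms in `w` and in the indicators of these events; their mean is nonpositive
under the sampling law. -/
lemma Model.exists_gap_le (hσ : 0 ≤ σ) (hκ : 0 ≤ κ) (hp : 0 < p) (hε : 0 ≤ ε)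
    {s : 𝒜} (hs : M.mean s = ⨆ b, M.mean b)
    (hconf : ∀ a, |⟪m - M.θ, M.feat a⟫| ≤ σ * invNorm A (M.feat a)) :
    ∃ w, 0 ≤ w ∧ ∀ (e : EuclideanSpace ℝ (Fin D)) (a : 𝒜),
      (∀ b, ⟪e, M.feat b⟫ ≤ ⟪e, M.feat a⟫) →
      (⨆ b, M.mean b) - M.mean a ≤ (1 + κ) * (1 + 4 / p) * (σ * invNorm A (M.feat a)) +
        2 * B * q + 2 * ε +
        (2 * (1 + κ) * (σ * w) * (1 - 2 / p * Set.indicator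
          ({e | σ * invNorm A (M.feat s) ≤ ⟪e - m, M.feat s⟫} ∩
            {e | ∀ b, |⟪e - m, M.feat b⟫| ≤ κ * (σ * invNorm A (M.feat b))}) 1 e) +
          2 * B * (Set.indicator
            {e | ∀ b, |⟪e - m, M.feat b⟫| ≤ κ * (σ * invNorm A (M.feat b))}ᶜ 1 e - q)) := by
  let W : 𝒜 → ℝ := fun a => σ * invNorm A (M.feat a)
  have hW : ∀ a, 0 ≤ W a := fun a => mul_nonneg hσ (invNorm_nonneg _ _)
  -- the unsaturated arms
  let U : Finset 𝒜 := {a | ⟪M.θ, M.feat s⟫ - ⟪M.θ, M.feat a⟫ ≤ (1 + κ) * W a}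
  have hsU : s ∈ U := by
    simp only [U, Finset.mem_filter, Finset.mem_univ, true_and, sub_self]
    exact mul_nonneg (by linarith) (hW s)
  obtain ⟨a₀, ha₀, hmin⟩ := U.exists_min_image (fun a => invNorm A (M.feat a)) ⟨s, hsU⟩
  refine ⟨invNorm A (M.feat a₀), invNorm_nonneg _ _, fun e a hmax => ?_⟩
  change _ ≤ (1 + κ) * (1 + 4 / p) * W a + 2 * B * q + 2 * ε + (2 * (1 + κ) * W a₀ * _ + _)
  have hB := M.nonneg_bound
  set O : Set (EuclideanSpace ℝ (Fin D)) :=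
    {e | σ * invNorm A (M.feat s) ≤ ⟪e - m, M.feat s⟫}
  set G : Set (EuclideanSpace ℝ (Fin D)) :=
    {e | ∀ b, |⟪e - m, M.feat b⟫| ≤ κ * (σ * invNorm A (M.feat b))}
  have hpinv : 0 < 1 / p := by positivity
  have h4 : 0 ≤ 4 / p := by positivity
  have hκ1 : 0 ≤ 1 + κ := by linarith
  by_cases hG : e ∈ G
  · have hacc : ∀ b, |⟪e, M.feat b⟫ - ⟪M.θ, M.feat b⟫| ≤ (1 + κ) * W b := by
      intro b
      have h1 : |⟪e - m, M.feat b⟫| ≤ κ * W b := hG b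
      have h2 : |⟪m - M.θ, M.feat b⟫| ≤ W b := hconf b
      have h3 : ⟪e, M.feat b⟫ - ⟪M.θ, M.feat b⟫ = ⟪e - m, M.feat b⟫ + ⟪m - M.θ, M.feat b⟫ := by
        rw [inner_sub_left, inner_sub_left]; ring
      rw [h3]
      refine (abs_add_le _ _).trans ?_
      linarith
    have hgap : (⨆ b, M.mean b) - M.mean a ≤ ⟪M.θ, M.feat s⟫ - ⟪M.θ, M.feat a⟫ + 2 * ε := by
      rw [← hs, Model.mean, Model.mean]
      linarith [(abs_le.1 (M.abs_bias_le s)).2, (abs_le.1 (M.abs_bias_le a)).1]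
    have ha₀' : ⟪M.θ, M.feat s⟫ - ⟪M.θ, M.feat a₀⟫ ≤ (1 + κ) * W a₀ := by
      simpa [U] using ha₀
    have hreg : ⟪M.θ, M.feat s⟫ - ⟪M.θ, M.feat a⟫ ≤ 2 * ((1 + κ) * W a₀) + (1 + κ) * W a := by
      linarith [(abs_le.1 (hacc a₀)).1, (abs_le.1 (hacc a)).2, hmax a₀]
    rw [Set.indicator_of_notMem (s := Gᶜ) (by simpa using hG)]
    by_cases hO : e ∈ O
    · rw [Set.indicator_of_mem (Set.mem_inter hO hG), Pi.one_apply]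
      have haU : a ∈ U := by
        simp only [U, Finset.mem_filter, Finset.mem_univ, true_and]
        have h1 : W s ≤ ⟪e - m, M.feat s⟫ := hO
        have h2 := (abs_le.1 (hconf s)).1
        rw [inner_sub_left] at h1 h2
        change -W s ≤ _ at h2
        linarith [hmax s, (abs_le.1 (hacc a)).2]
      have hle : W a₀ ≤ W a := mul_le_mul_of_nonneg_left (hmin a haU) hσ
      have h5 : (1 + κ) * (4 / p) * W a₀ ≤ (1 + κ) * (4 / p) * W a := by gcongr
      have e1 : (1 + κ) * (1 + 4 / p) * W a + 2 * B * q + 2 * ε +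
          (2 * (1 + κ) * W a₀ * (1 - 2 / p * 1) + 2 * B * (0 - q)) =
          (1 + κ) * W a + (1 + κ) * (4 / p) * W a + 2 * ε + 2 * ((1 + κ) * W a₀) -
          (1 + κ) * (4 / p) * W a₀ := by ring
      rw [e1]
      linarith
    · rw [Set.indicator_of_notMem (s := O ∩ G) (fun h => hO h.1)]
      have h5 : 0 ≤ (1 + κ) * (4 / p) * W a := by have := hW a; positivity
      linarith
  · rw [Set.indicator_of_notMem (s := O ∩ G) (fun h => hG h.2),
      Set.indicator_of_mem (s := Gᶜ) hG, Pi.one_apply]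
    have h5 : 0 ≤ (1 + κ) * (1 + 4 / p) * W a := by have := hW a; positivity
    have h6 : 0 ≤ 2 * (1 + κ) * W a₀ := by have := hW a₀; positivity
    linarith [M.gap_le a]

/-- The expected regret of one round of Thompson sampling, for a sample from `N(m, σ² A⁻¹)`, is at
most a multiple of the expected width of the selected arm, up to small terms. Here `p` is the
probability that the sample is optimistic and `q` bounds the probability that it is not
`κ`-accurate. -/
lemma Model.integral_gap_sub_le [MeasurableSpace 𝒜] [MeasurableSingletonClass 𝒜]
    (hA : A.PosDef) (hσ : 0 ≤ σ) (hκ : 0 ≤ κ) (hε : 0 ≤ ε)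
    (hp : p = (gaussianReal 0 1).real (Set.Ici 1))
    (hq : Fintype.card 𝒜 * (2 * Real.exp (-(κ ^ 2 / 2))) ≤ q) (hqp : q ≤ p / 2)
    (hconf : ∀ a, |⟪m - M.θ, M.feat a⟫| ≤ σ * invNorm A (M.feat a))
    (K : Measure (EuclideanSpace ℝ (Fin D) × 𝒜)) [IsProbabilityMeasure K]
    (hK : K.map Prod.fst = multivariateGaussian m (σ ^ 2 • A⁻¹))
    (hmax : ∀ᵐ e ∂K, ∀ b, ⟪e.1, M.feat b⟫ ≤ ⟪e.1, M.feat e.2⟫) :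
    ∫ e, ((⨆ b, M.mean b) - M.mean e.2 -
      (1 + κ) * (1 + 4 / p) * (σ * invNorm A (M.feat e.2)) - (2 * B * q + 2 * ε)) ∂K ≤ 0 := by
  have hp0 : 0 < p := hp ▸ gaussianReal_real_Ici_pos 1
  have hB := M.nonneg_bound
  obtain ⟨s, hs⟩ := M.exists_mean_eq_iSup
  obtain ⟨w, hw, hgap⟩ := M.exists_gap_le hσ hκ hp0 hε hs hconf
  set ν := multivariateGaussian m (σ ^ 2 • A⁻¹)
  set O : Set (EuclideanSpace ℝ (Fin D)) :=
    {e | σ * invNorm A (M.feat s) ≤ ⟪e - m, M.feat s⟫}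
  set G : Set (EuclideanSpace ℝ (Fin D)) :=
    {e | ∀ b, |⟪e - m, M.feat b⟫| ≤ κ * (σ * invNorm A (M.feat b))}
  have hO : MeasurableSet O := measurableSet_le measurable_const (by fun_prop)
  have hG : MeasurableSet G := by
    have : G = ⋂ b, {e | |⟪e - m, M.feat b⟫| ≤ κ * (σ * invNorm A (M.feat b))} := by
      ext; simp [G]
    rw [this]
    exact MeasurableSet.iInter fun b => measurableSet_le (by fun_prop) measurable_const
  have hνG : ν.real Gᶜ ≤ q := by
    have : Gᶜ = ⋃ b, {e | κ * (σ * invNorm A (M.feat b)) < |⟪e - m, M.feat b⟫|} := by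
      ext; simp [G]
    rw [this]
    refine (measureReal_iUnion_fintype_le _).trans ((Finset.sum_le_sum fun b _ =>
      multivariateGaussian_real_abs_gt_le hA hσ hκ (M.feat b)).trans ?_)
    simpa using hq
  have hνO : p ≤ ν.real O := hp ▸ multivariateGaussian_real_ge hA hσ (M.feat s)
  have hνOG : p / 2 ≤ ν.real (O ∩ G) := by
    have : ν.real O ≤ ν.real (O ∩ G) + ν.real Gᶜ := by
      refine (measureReal_mono fun e he => ?_).trans (measureReal_union_le _ _)
      by_cases h : e ∈ G
      · exact Or.inl ⟨he, h⟩
      · exact Or.inr h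
    linarith
  let Y : EuclideanSpace ℝ (Fin D) → ℝ := fun e =>
    2 * (1 + κ) * (σ * w) * (1 - 2 / p * (O ∩ G).indicator 1 e) +
      2 * B * (Gᶜ.indicator 1 e - q)
  have hi1 : Integrable ((O ∩ G).indicator (1 : EuclideanSpace ℝ (Fin D) → ℝ)) ν :=
    (integrable_const 1).indicator (hO.inter hG)
  have hi2 : Integrable (Gᶜ.indicator (1 : EuclideanSpace ℝ (Fin D) → ℝ)) ν :=
    (integrable_const 1).indicator hG.compl
  have hj1 : Integrable (fun e => 2 * (1 + κ) * (σ * w) * (1 - 2 / p * (O ∩ G).indicator 1 e)) ν :=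
    ((integrable_const 1).sub (hi1.const_mul _)).const_mul _
  have hj2 : Integrable (fun e => 2 * B * (Gᶜ.indicator 1 e - q)) ν :=
    (hi2.sub (integrable_const q)).const_mul _
  have hYi : Integrable Y ν := hj1.add hj2
  have hY : ∫ e, Y e ∂ν ≤ 0 := by
    have : ∫ e, Y e ∂ν = 2 * (1 + κ) * (σ * w) * (1 - 2 / p * ν.real (O ∩ G)) +
        2 * B * (ν.real Gᶜ - q) := by
      simp only [Y]
      rw [integral_add hj1 hj2, integral_const_mul, integral_const_mul,
        integral_sub (integrable_const 1) (hi1.const_mul _), integral_const_mul,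
        integral_sub hi2 (integrable_const q), integral_indicator_one (hO.inter hG),
        integral_indicator_one hG.compl]
      simp
    rw [this]
    have h1 : 1 ≤ 2 / p * ν.real (O ∩ G) := by
      calc (1 : ℝ) = 2 / p * (p / 2) := by field_simp
        _ ≤ _ := by gcongr
    have h2 : 0 ≤ 2 * (1 + κ) * (σ * w) := by positivity
    have h3 := mul_nonneg h2 (sub_nonneg.2 h1)
    have h4 := mul_nonneg (by linarith : 0 ≤ 2 * B) (sub_nonneg.2 hνG)
    linarith
  rw [← hK] at hYi hY
  rw [integral_map measurable_fst.aemeasurable hYi.aestronglyMeasurable] at hY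
  have hYK := (integrable_map_measure hYi.aestronglyMeasurable measurable_fst.aemeasurable).1 hYi
  refine le_trans (integral_mono_ae ?_ hYK ?_) hY
  · let g : 𝒜 → ℝ := fun a => (⨆ b, M.mean b) - M.mean a -
      (1 + κ) * (1 + 4 / p) * (σ * invNorm A (M.feat a)) - (2 * B * q + 2 * ε)
    obtain ⟨c, hc⟩ := (Set.finite_range fun a => ‖g a‖).bddAbove
    exact Integrable.of_bound
      ((Measurable.of_discrete (f := g)).comp measurable_snd).aestronglyMeasurable c
      (ae_of_all _ fun e => hc ⟨e.2, rfl⟩)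
  · filter_upwards [hmax] with e he
    have := hgap e.1 e.2 he
    simp only [Function.comp_apply, Y]
    linarith

end OneStep

end MisspecifiedBandit

namespace MisspecifiedBandit

/-! ### The history of the interaction -/

section History

variable {Ω 𝒜 : Type*} [MeasurableSpace 𝒜] {x : ℕ → Ω → 𝒜} {y : ℕ → Ω → ℝ} {t : ℕ}

lemma history_mono (x : ℕ → Ω → 𝒜) (y : ℕ → Ω → ℝ) :
    Monotone (history x y) := fun _ _ hst =>
  biSup_mono fun _ hs => Finset.Icc_subset_Icc_right hst hs

lemma measurable_action_history {s : ℕ} (hs : s ∈ Finset.Icc 1 t) :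
    Measurable[history x y t] (x s) :=
  Measurable.mono (comap_measurable (x s)) (le_sup_left.trans (le_iSup₂_of_le s hs le_rfl)) le_rfl

lemma measurable_reward_history {s : ℕ} (hs : s ∈ Finset.Icc 1 t) :
    Measurable[history x y t] (y s) :=
  Measurable.mono (comap_measurable (y s)) (le_sup_right.trans (le_iSup₂_of_le s hs le_rfl)) le_rfl

lemma IsInteraction.history_le [mΩ : MeasurableSpace Ω] {P : Measure Ω} {ℱ : Filtration ℕ mΩ}
    {D T : ℕ} {B ε R : ℝ} {M : Model 𝒜 D B ε} {η : ℕ → Ω → ℝ}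
    (hI : IsInteraction M R T P ℱ x y η) (ht : t ≤ T) :
    history x y t ≤ mΩ := by
  refine iSup₂_le fun s hs => sup_le ?_ ?_ <;> rw [Finset.mem_Icc] at hs
  · exact ((hI.action_measurable s (Finset.mem_Icc.2 ⟨hs.1, hs.2.trans ht⟩)).mono (ℱ.le _)
      le_rfl).comap_le
  · exact ((hI.reward_measurable s (Finset.mem_Icc.2 ⟨hs.1, hs.2.trans ht⟩)).mono (ℱ.le _)
      le_rfl).comap_le

end History

/-! ### Regret in excess of the posterior widths -/

section Excess

variable {Ω 𝒜 : Type*} {D : ℕ} {B ε : ℝ} {M : Model 𝒜 D B ε} {R lam δ k r : ℝ}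
  {x : ℕ → Ω → 𝒜} {y : ℕ → Ω → ℝ} {t : ℕ}

lemma cumWidth_nonneg (z : ℕ → EuclideanSpace ℝ (Fin D)) : 0 ≤ cumWidth lam z t :=
  Finset.sum_nonneg fun _ _ => invNorm_nonneg _ _

lemma sampleScale_nonneg (hR : 0 ≤ R) (hB : 0 ≤ B) (hε : 0 ≤ ε)
    (z : ℕ → EuclideanSpace ℝ (Fin D)) : 0 ≤ sampleScale R B ε lam δ z t := by
  have := cumWidth_nonneg (lam := lam) (t := t) z
  rw [sampleScale, confRadius]
  positivity

/-- The least squares estimate after round `t` is accurate for the features of all arms. -/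
def IsAccurate (M : Model 𝒜 D B ε) (R lam δ : ℝ) (x : ℕ → Ω → 𝒜) (y : ℕ → Ω → ℝ) (t : ℕ)
    (ω : Ω) : Prop :=
  ∀ b, |⟪leastSquares lam (fun s => M.feat (x s ω)) (fun s => y s ω) t - M.θ, M.feat b⟫| ≤
    sampleScale R B ε lam δ (fun s => M.feat (x s ω)) t *
      invNorm (designMatrix lam (fun s => M.feat (x s ω)) t) (M.feat b)

open Classical in
/-- The amount by which the regret of playing the arm `p.2` in round `t + 1` exceeds `k` times its
posterior standard deviation plus `r`; it is set to zero when the estimate after round `t` is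
inaccurate. -/
noncomputable def excess (M : Model 𝒜 D B ε) (R lam δ k r : ℝ) (x : ℕ → Ω → 𝒜) (y : ℕ → Ω → ℝ)
    (t : ℕ) (p : Ω × 𝒜) : ℝ :=
  if IsAccurate M R lam δ x y t p.1 then
    (⨆ b, M.mean b) - M.mean p.2 - k * (sampleScale R B ε lam δ (fun s => M.feat (x s p.1)) t *
      invNorm (designMatrix lam (fun s => M.feat (x s p.1)) t) (M.feat p.2)) - r
  else 0

variable [Fintype 𝒜]

lemma measurable_excess [MeasurableSpace 𝒜] [MeasurableSingletonClass 𝒜] {m : MeasurableSpace Ω}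
    (hx : ∀ s ∈ Finset.Icc 1 t, Measurable (x s)) (hy : ∀ s ∈ Finset.Icc 1 t, Measurable (y s)) :
    Measurable (excess M R lam δ k r x y t) := by
  have hz : ∀ s ∈ Finset.Icc 1 t, Measurable fun ω => M.feat (x s ω) := fun s hs =>
    (Measurable.of_discrete (f := M.feat)).comp (hx s hs)
  have hσ : Measurable fun ω => sampleScale R B ε lam δ (fun s => M.feat (x s ω)) t :=
    (measurable_confRadius (z := fun s ω => M.feat (x s ω)) hz).add
      ((measurable_cumWidth (z := fun s ω => M.feat (x s ω)) hz).const_mul ε)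
  have hw : ∀ a, Measurable fun ω => sampleScale R B ε lam δ (fun s => M.feat (x s ω)) t *
      invNorm (designMatrix lam (fun s => M.feat (x s ω)) t) (M.feat a) := fun a =>
    hσ.mul (measurable_invNorm (measurable_designMatrix (z := fun s ω => M.feat (x s ω)) hz)
      measurable_const)
  have hl : ∀ a, Measurable fun ω =>
      |⟪leastSquares lam (fun s => M.feat (x s ω)) (fun s => y s ω) t - M.θ, M.feat a⟫| := by
    intro a
    simp only [inner_sub_left]
    exact ((measurable_inner_leastSquares (z := fun s ω => M.feat (x s ω)) hz hy _).sub_const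
      _).abs
  refine measurable_from_prod_countable_left fun a => Measurable.ite ?_ ?_ measurable_const
  · simp only [IsAccurate, Set.ofPred_forall]
    exact MeasurableSet.iInter fun b => measurableSet_le (hl b) (hw b)
  · exact (((hw a).const_mul k).const_sub ((⨆ b, M.mean b) - M.mean a)).sub_const r

lemma abs_excess_le [Nonempty 𝒜] (hR : 0 ≤ R) (hε : 0 ≤ ε) (hlam : 1 ≤ lam) (hk : 0 ≤ k)
    (hr : 0 ≤ r) {ω : Ω} {v : ℝ} (hv : sampleScale R B ε lam δ (fun s => M.feat (x s ω)) t ≤ v)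
    (a : 𝒜) : |excess M R lam δ k r x y t (ω, a)| ≤ 2 * B + k * v + r := by
  have hB := M.nonneg_bound
  have hσ : 0 ≤ sampleScale R B ε lam δ (fun s => M.feat (x s ω)) t :=
    sampleScale_nonneg hR hB hε _
  have hw : invNorm (designMatrix lam (fun s => M.feat (x s ω)) t) (M.feat a) ≤ 1 := by
    refine (invNorm_designMatrix_le (by linarith) t _).trans
      (div_le_one_of_le₀ ((M.norm_feat_le a).trans (Real.one_le_sqrt.2 hlam)) (Real.sqrt_nonneg _))
  have hw0 := invNorm_nonneg (designMatrix lam (fun s => M.feat (x s ω)) t) (M.feat a)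
  have h1 : sampleScale R B ε lam δ (fun s => M.feat (x s ω)) t *
      invNorm (designMatrix lam (fun s => M.feat (x s ω)) t) (M.feat a) ≤ v :=
    (mul_le_of_le_one_right hσ hw).trans hv
  have h2 := mul_le_mul_of_nonneg_left h1 hk
  have h3 := mul_nonneg hk (mul_nonneg hσ hw0)
  have h4 := M.gap_nonneg a
  have h5 := M.gap_le a
  rw [excess]
  split_ifs
  · rw [abs_le]
    constructor <;> linarith
  · rw [abs_zero]
    linarith

instance isProbabilityMeasure_samplingLaw (z : ℕ → EuclideanSpace ℝ (Fin D)) (y : ℕ → ℝ) (t : ℕ) :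
    IsProbabilityMeasure (samplingLaw R B ε lam δ z y t) := by
  rw [samplingLaw]; infer_instance

variable [Nonempty 𝒜] [mΩ : MeasurableSpace Ω] [MeasurableSpace 𝒜] [MeasurableSingletonClass 𝒜]
  {P : Measure Ω} [IsProbabilityMeasure P] {ℱ : Filtration ℕ mΩ} {η : ℕ → Ω → ℝ} {T : ℕ}
  {μ : ℕ → Ω → EuclideanSpace ℝ (Fin D)} {κ q p : ℝ}

/-- Given the history, the excess regret of the next round has nonpositive mean. -/
lemma IsThompsonSampling.condExp_excess_nonpos (hI : IsInteraction M R T P ℱ x y η)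
    (hTS : IsThompsonSampling M R lam δ T P x y μ) (hR : 0 ≤ R) (hlam : 1 ≤ lam) (hε : 0 ≤ ε)
    (hκ : 0 ≤ κ) (hp : p = (gaussianReal 0 1).real (Set.Ici 1))
    (hq : Fintype.card 𝒜 * (2 * Real.exp (-(κ ^ 2 / 2))) ≤ q) (hqp : q ≤ p / 2)
    (ht : t < T) {c : ℝ}
    (hc : ∀ ω, |excess M R lam δ ((1 + κ) * (1 + 4 / p)) (2 * B * q + 2 * ε) x y t
      (ω, x (t + 1) ω)| ≤ c) :
    P[fun ω => excess M R lam δ ((1 + κ) * (1 + 4 / p)) (2 * B * q + 2 * ε) x y t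
      (ω, x (t + 1) ω) | history x y t] ≤ᵐ[P] 0 := by
  have hxt : Measurable (x (t + 1)) :=
    (hI.action_measurable _ (Finset.mem_Icc.2 ⟨by omega, ht⟩)).mono (ℱ.le _) le_rfl
  have hcomap : MeasurableSpace.comap id (history x y t) = history x y t :=
    MeasurableSpace.comap_id
  have hH : MeasurableSet {e : EuclideanSpace ℝ (Fin D) × 𝒜 |
      ∀ b, ⟪e.1, M.feat b⟫ ≤ ⟪e.1, M.feat e.2⟫} := by
    simp only [Set.ofPred_forall]
    have hfeat : Measurable M.feat := Measurable.of_discrete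
    exact MeasurableSet.iInter fun b => measurableSet_le (by fun_prop) (by fun_prop)
  have := @condExp_nonpos_of_law Ω (EuclideanSpace ℝ (Fin D)) 𝒜 Ω mΩ _ _ (history x y t) _ _ _ _
    P _ id (measurable_id'' (hI.history_le ht.le)) (μ t) (x (t + 1)) (hTS.sample_measurable t ht)
    hxt (fun ω => samplingLaw R B ε lam δ (fun s => M.feat (x s ω)) (fun s => y s ω) t) _
    (by rw [hcomap]; exact hTS.sample_law t ht) _ hH (fun ω b => hTS.action_argmax t ht ω b)
    (excess M R lam δ ((1 + κ) * (1 + 4 / p)) (2 * B * q + 2 * ε) x y t)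
    (@measurable_excess _ _ _ _ _ _ _ _ _ _ _ _ _ _ _ _ _ (history x y t)
      (fun s hs => measurable_action_history hs) (fun s hs => measurable_reward_history hs))
    c hc ?_
  · rwa [hcomap] at this
  · intro ω K hK hfst hmax
    by_cases hacc : IsAccurate M R lam δ x y t ω
    · simp only [excess, id, if_pos hacc]
      exact M.integral_gap_sub_le (posDef_designMatrix (by linarith) t)
        (sampleScale_nonneg hR M.nonneg_bound hε _) hκ hε hp hq hqp hacc K hfst hmax
    · simp [excess, if_neg hacc]

end Excess

end MisspecifiedBandit

namespace MisspecifiedBandit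

/-! ### Deterministic bounds for the radius and the rate -/

section Bounds

variable {D : ℕ} {lam R B ε δ : ℝ}

/-- The deterministic bound `v` for the sampling scale over the horizon `T`. -/
lemma sampleScale_le (hR : 0 ≤ R) (hlam : 1 ≤ lam) (hε : 0 ≤ ε) (hδ : 0 < δ)
    {z : ℕ → EuclideanSpace ℝ (Fin D)} (hz : ∀ s, ‖z s‖ ≤ 1) {t T : ℕ} (ht : t ≤ T) :
    sampleScale R B ε lam δ z t ≤ R * √(D * Real.log (1 + T) + 2 * Real.log (2 / δ)) + √lam * B +
      ε * √(2 * (T * (D * Real.log (1 + T)))) := by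
  have hl : 0 < lam := by linarith
  have htT : (t : ℝ) ≤ T := by exact_mod_cast ht
  have ht0 : (0 : ℝ) ≤ t := t.cast_nonneg
  have hlog : Real.log (1 + t) ≤ Real.log (1 + T) := Real.log_le_log (by linarith) (by linarith)
  have hlog0 : 0 ≤ Real.log (1 + t) := Real.log_nonneg (by linarith)
  have h1 : Real.log ((lam⁻¹ • designMatrix lam z t).det / (δ / 2) ^ 2) ≤
      D * Real.log (1 + T) + 2 * Real.log (2 / δ) := by
    rw [Real.log_div (det_designMatrix_pos hl t).ne' (by positivity), Real.log_pow]
    have h2 : Real.log (2 / δ) = - Real.log (δ / 2) := by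
      rw [← Real.log_inv, inv_div]
    have h3 := log_det_designMatrix_le hlam hz t
    have h4 : (D : ℝ) * Real.log (1 + t) ≤ D * Real.log (1 + T) := by gcongr
    rw [h2]
    push_cast
    linarith
  have h2 : cumWidth lam z t ≤ √(2 * (T * (D * Real.log (1 + T)))) :=
    (sum_invNorm_le hlam hz t).trans (Real.sqrt_le_sqrt (by gcongr))
  rw [sampleScale, confRadius]
  gcongr

/-- The terms of the regret bound, in terms of `d = √D`, `τ = √T`, `ρ = √(log (1/δ))`,
`n = √(log N)` and `ℓ = 1 + log T`. -/
lemma regret_terms_le {d τ ρ n ℓ k v c₁ c₂ : ℝ} (hd : 1 ≤ d) (hτ : 1 ≤ τ) (hρ : 0 ≤ ρ)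
    (hn : 1 / 2 ≤ n) (hℓ : 1 ≤ ℓ) (hB : 0 ≤ B) (hε : 0 ≤ ε) (hk : 0 ≤ k) (hv0 : 0 ≤ v)
    (hc₁ : 0 ≤ c₁) (hkn : k ≤ c₂ * (n * ℓ)) (hv : v ≤ c₁ * (ℓ * (d + ρ + ε * (τ * d)))) :
    (4 * B + k * v + 2 * ε) * (2 * (τ * (d + ρ))) + k * v * (2 * (τ * d * ℓ)) + 2 * B +
      2 * τ ^ 2 * ε ≤ (8 * (c₁ * c₂) + 20 * B + 12) * ℓ ^ 3 *
        (n * (d ^ 2 * τ + d * τ * ρ + ρ ^ 2 * τ + (d ^ 2 * τ ^ 2 + τ ^ 2 * (d * ρ)) * ε)) := by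
  obtain ⟨I, hI⟩ : ∃ I, I =
    d ^ 2 * τ + d * τ * ρ + ρ ^ 2 * τ + (d ^ 2 * τ ^ 2 + τ ^ 2 * (d * ρ)) * ε := ⟨_, rfl⟩
  rw [← hI]
  have hd2 : d ≤ d ^ 2 := by nlinarith
  have hτ2 : τ ≤ τ ^ 2 := by nlinarith
  have hd0 : 0 ≤ d := by linarith
  have hτ0 : 0 ≤ τ := by linarith
  have hℓ0 : 0 ≤ ℓ := by linarith
  have hn0 : 0 ≤ n := by linarith
  have p1 : 0 ≤ d ^ 2 * τ := by positivity
  have p2 : 0 ≤ d * τ * ρ := by positivity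
  have p3 : 0 ≤ ρ ^ 2 * τ := by positivity
  have p4 : 0 ≤ d ^ 2 * τ ^ 2 * ε := by positivity
  have p5 : 0 ≤ τ ^ 2 * (d * ρ) * ε := by positivity
  have hI0 : 0 ≤ I := by rw [hI]; positivity
  -- the contributions that do not involve the sampling width
  have a1 : τ * (d + ρ) ≤ I := by
    have q1 : τ * d ≤ d ^ 2 * τ := by nlinarith
    have q2 : τ * ρ ≤ d * τ * ρ := by nlinarith [mul_nonneg hτ0 hρ]
    linarith
  have a2 : ε * (τ * (d + ρ)) ≤ I := by
    have q1 : τ * d ≤ d ^ 2 * τ ^ 2 := by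
      calc τ * d ≤ τ ^ 2 * d ^ 2 := by gcongr
        _ = _ := by ring
    have q2 : τ * ρ ≤ τ ^ 2 * (d * ρ) := by
      have : ρ ≤ d * ρ := by nlinarith
      gcongr
    have q3 := mul_le_mul_of_nonneg_right q1 hε
    have q4 := mul_le_mul_of_nonneg_right q2 hε
    linarith
  have a3 : 1 ≤ I := by
    have : (1 : ℝ) * 1 ≤ d ^ 2 * τ := mul_le_mul (by nlinarith) hτ zero_le_one (by positivity)
    linarith
  have a4 : τ ^ 2 * ε ≤ I := by
    have : 1 * (τ ^ 2 * ε) ≤ d ^ 2 * (τ ^ 2 * ε) :=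
      mul_le_mul_of_nonneg_right (by nlinarith) (by positivity)
    linarith
  -- the leading contribution
  have b1 : (d + ρ + ε * (τ * d)) * (τ * (d + ρ)) ≤ 2 * I := by
    have : (d + ρ + ε * (τ * d)) * (τ * (d + ρ)) =
        d ^ 2 * τ + 2 * (d * τ * ρ) + ρ ^ 2 * τ + (d ^ 2 * τ ^ 2 + τ ^ 2 * (d * ρ)) * ε := by ring
    rw [this, hI]
    linarith
  have b2 : 2 * (τ * (d + ρ)) + 2 * (τ * d * ℓ) ≤ 4 * (ℓ * (τ * (d + ρ))) := by
    have q1 : τ * (d + ρ) ≤ ℓ * (τ * (d + ρ)) := le_mul_of_one_le_left (by positivity) hℓ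
    have q2 : 0 ≤ ℓ * (τ * ρ) := by positivity
    nlinarith
  have b3 : k * v ≤ c₂ * (n * ℓ) * (c₁ * (ℓ * (d + ρ + ε * (τ * d)))) :=
    mul_le_mul hkn hv hv0 (hk.trans hkn)
  have hc₂ : 0 ≤ c₂ * (n * ℓ) := hk.trans hkn
  have b4 : k * v * (2 * (τ * (d + ρ)) + 2 * (τ * d * ℓ)) ≤ 8 * (c₁ * c₂) * ℓ ^ 3 * (n * I) := by
    calc k * v * (2 * (τ * (d + ρ)) + 2 * (τ * d * ℓ))
        ≤ c₂ * (n * ℓ) * (c₁ * (ℓ * (d + ρ + ε * (τ * d)))) * (4 * (ℓ * (τ * (d + ρ)))) :=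
          mul_le_mul b3 b2 (by positivity) ((mul_nonneg hk hv0).trans b3)
      _ = c₂ * (n * ℓ) * (4 * (c₁ * ℓ ^ 2)) * ((d + ρ + ε * (τ * d)) * (τ * (d + ρ))) := by ring
      _ ≤ c₂ * (n * ℓ) * (4 * (c₁ * ℓ ^ 2)) * (2 * I) :=
          mul_le_mul_of_nonneg_left b1 (mul_nonneg hc₂ (by positivity))
      _ = _ := by ring
  have b5 : (10 * B + 6) * I ≤ (20 * B + 12) * ℓ ^ 3 * (n * I) := by
    have q1 : 1 ≤ ℓ ^ 3 := one_le_pow₀ hℓ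
    have q2 : 1 / 2 ≤ ℓ ^ 3 * n := by nlinarith
    calc (10 * B + 6) * I = (20 * B + 12) * (1 / 2) * I := by ring
      _ ≤ (20 * B + 12) * (ℓ ^ 3 * n) * I := by gcongr
      _ = _ := by ring
  have c1 := mul_le_mul_of_nonneg_left a1 hB
  have c3 := mul_le_mul_of_nonneg_left a3 hB
  linarith

lemma sqrt_deviation_le {L d τ ρ : ℝ} (hd : 1 ≤ d) (hτ : 0 ≤ τ) (hρ : 0 ≤ ρ)
    (hL : L ≤ 1 + ρ ^ 2) : √(2 * τ ^ 2 * L) ≤ 2 * (τ * (d + ρ)) := by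
  refine Real.sqrt_le_iff.2 ⟨by positivity, ?_⟩
  have h1 : 2 * τ ^ 2 * L ≤ 2 * τ ^ 2 * (1 + ρ ^ 2) := by gcongr
  have h2 : 1 + ρ ^ 2 ≤ (d + ρ) ^ 2 := by nlinarith
  have h3 : 2 * τ ^ 2 * (1 + ρ ^ 2) ≤ 2 * τ ^ 2 * (d + ρ) ^ 2 := by gcongr
  nlinarith [sq_nonneg (τ * (d + ρ))]

lemma sqrt_width_le {D T d τ ℓ L : ℝ} (hd : d ^ 2 = D) (hτ : τ ^ 2 = T) (hd0 : 0 ≤ d)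
    (hτ0 : 0 ≤ τ) (hℓ : 1 ≤ ℓ) (hL : L ≤ ℓ) : √(2 * (T * (D * L))) ≤ 2 * (τ * d * ℓ) := by
  refine Real.sqrt_le_iff.2 ⟨by positivity, ?_⟩
  have h1 : (2 * (τ * d * ℓ)) ^ 2 = 4 * (τ ^ 2 * (d ^ 2 * ℓ ^ 2)) := by ring
  have h2 : L ≤ ℓ ^ 2 := hL.trans (by nlinarith)
  have h3 : τ ^ 2 * (d ^ 2 * L) ≤ τ ^ 2 * (d ^ 2 * ℓ ^ 2) := by gcongr
  have h4 : 0 ≤ τ ^ 2 * (d ^ 2 * ℓ ^ 2) := by positivity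
  rw [h1, ← hd, ← hτ]
  linarith

lemma sqrt_radius_le {D d ρ ℓ L L' : ℝ} (hd2 : d ^ 2 = D) (hd : 1 ≤ d) (hρ : 0 ≤ ρ) (hℓ : 1 ≤ ℓ)
    (hL : L ≤ ℓ) (hL' : L' ≤ 1 + ρ ^ 2) : √(D * L + 2 * L') ≤ 2 * (ℓ * (d + ρ)) := by
  refine Real.sqrt_le_iff.2 ⟨by positivity, ?_⟩
  have h2 : D * L ≤ d ^ 2 * ℓ := by rw [← hd2]; gcongr
  have h3 : (2 * (ℓ * (d + ρ))) ^ 2 = 4 * ℓ ^ 2 * (d ^ 2 + 2 * (d * ρ) + ρ ^ 2) := by ring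
  have h4 : ℓ ≤ ℓ ^ 2 := by nlinarith
  have h5 : d ^ 2 * ℓ ≤ d ^ 2 * ℓ ^ 2 := by gcongr
  have h6 : 1 * 1 ≤ d ^ 2 * ℓ ^ 2 :=
    mul_le_mul (one_le_pow₀ hd) (one_le_pow₀ hℓ) zero_le_one (by positivity)
  have h7 : ρ ^ 2 * 1 ≤ ρ ^ 2 * ℓ ^ 2 := by gcongr; exact one_le_pow₀ hℓ
  have h8 : 0 ≤ ℓ ^ 2 * (d * ρ) := by positivity
  have h9 : 0 ≤ ρ ^ 2 * ℓ ^ 2 := by positivity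
  rw [h3]
  linarith

lemma sqrt_log_card_le {m N T n : ℝ} (hm : 1 ≤ m) (hN : 0 < N) (hT : 1 ≤ T)
    (hlN : 1 / 2 ≤ Real.log N) (hn0 : 0 ≤ n) (hn : n ^ 2 = Real.log N) :
    √(2 * Real.log (2 * m * N * T)) ≤
      √(4 * Real.log (2 * m) + 6) * (n * (1 + Real.log T)) := by
  have hlT : 0 ≤ Real.log T := Real.log_nonneg hT
  have hlm : 0 ≤ Real.log (2 * m) := Real.log_nonneg (by linarith)
  have h1 : √(4 * Real.log (2 * m) + 6) * (n * (1 + Real.log T)) =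
      √((4 * Real.log (2 * m) + 6) * (n * (1 + Real.log T)) ^ 2) := by
    rw [Real.sqrt_mul (by linarith), Real.sqrt_sq (by positivity)]
  rw [h1]
  apply Real.sqrt_le_sqrt
  rw [Real.log_mul (by positivity) (by positivity), Real.log_mul (by positivity) (by positivity),
    mul_pow, hn]
  generalize Real.log (2 * m) = a at *
  generalize Real.log N = b at *
  generalize Real.log T = c at *
  have h2 : c ≤ 2 * b * c := le_mul_of_one_le_left hlT (by linarith)
  have h3 : b * (1 + 2 * c) ≤ b * (1 + c) ^ 2 := by gcongr; nlinarith
  have h4 : 1 ≤ 2 * (b * (1 + c) ^ 2) := by nlinarith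
  have h5 : a ≤ a * (2 * (b * (1 + c) ^ 2)) := le_mul_of_one_le_right hlm h4
  linarith

/-- The accuracy level `κ = √(2 log (2 m N T))` makes a union bound over `N` arms fail with
probability `1 / (m T)`. -/
lemma mul_exp_neg_sq_le {m N T : ℝ} (hm : 1 ≤ m) (hN : 1 ≤ N) (hT : 1 ≤ T) :
    N * (2 * Real.exp (-(√(2 * Real.log (2 * m * N * T)) ^ 2 / 2))) ≤ 1 / (m * T) := by
  have h1 : 1 ≤ 2 * m * N := one_le_mul_of_one_le_of_one_le (by linarith) hN
  have h2 : 1 ≤ 2 * m * N * T := one_le_mul_of_one_le_of_one_le h1 hT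
  rw [Real.sq_sqrt (mul_nonneg zero_le_two (Real.log_nonneg h2)),
    mul_div_cancel_left₀ _ two_ne_zero, Real.exp_neg, Real.exp_log (by linarith)]
  apply le_of_eq
  field_simp

/-- The high-probability regret bound is at most the rate, up to a constant that depends only on
`R`, `B`, `lam` (and the absolute constants `p` and `m`) and the factor `(1 + log T) ^ 3`. -/
lemma regret_bound_le_rate {N D T : ℕ} {R B lam ε δ p m κ q v : ℝ} (hN : 2 ≤ N) (hD : 1 ≤ D)
    (hT : 1 ≤ T) (hR : 0 ≤ R) (hB : 0 ≤ B) (hε : 0 ≤ ε) (hδ : 0 < δ) (hδ1 : δ < 1)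
    (hp0 : 0 < p) (hm1 : 1 ≤ m) (hκ : κ = √(2 * Real.log (2 * m * N * T))) (hqT : q ≤ 1 / T)
    (hv : v = R * √(D * Real.log (1 + T) + 2 * Real.log (2 / δ)) + √lam * B +
      ε * √(2 * (T * (D * Real.log (1 + T))))) :
    (2 * B + (1 + κ) * (1 + 4 / p) * v + (2 * B * q + 2 * ε)) * √(2 * T * Real.log (2 / δ)) +
      (1 + κ) * (1 + 4 / p) * v * √(2 * (T * (D * Real.log (1 + T)))) +
      T * (2 * B * q + 2 * ε) ≤
    (8 * ((2 * R + √lam * B + 2) * ((2 + √(4 * Real.log (2 * m) + 6)) * (1 + 4 / p))) +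
      20 * B + 12) * (1 + Real.log T) ^ 3 * rate N D T ε δ := by
  have hD' : (1 : ℝ) ≤ D := by exact_mod_cast hD
  have hT' : (1 : ℝ) ≤ T := by exact_mod_cast hT
  have hN' : (2 : ℝ) ≤ N := by exact_mod_cast hN
  have hlT : 0 ≤ Real.log T := Real.log_nonneg hT'
  have hlN : 1 / 2 ≤ Real.log N :=
    le_trans (by linarith [Real.log_two_gt_d9]) (Real.log_le_log two_pos hN')
  have hL : 0 < Real.log (1 / δ) := Real.log_pos (by rw [lt_div_iff₀ hδ]; linarith)
  obtain ⟨ℓ, hℓdef⟩ : ∃ ℓ, ℓ = 1 + Real.log T := ⟨_, rfl⟩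
  have hℓ : 1 ≤ ℓ := by linarith
  obtain ⟨d, hddef⟩ : ∃ d, d = √(D : ℝ) := ⟨_, rfl⟩
  obtain ⟨τ, hτdef⟩ : ∃ τ, τ = √(T : ℝ) := ⟨_, rfl⟩
  obtain ⟨ρ, hρdef⟩ : ∃ ρ, ρ = √(Real.log (1 / δ)) := ⟨_, rfl⟩
  obtain ⟨n, hndef⟩ : ∃ n, n = √(Real.log N) := ⟨_, rfl⟩
  have hd : 1 ≤ d := hddef ▸ Real.one_le_sqrt.2 hD'
  have hτ : 1 ≤ τ := hτdef ▸ Real.one_le_sqrt.2 hT'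
  have hρ : 0 ≤ ρ := hρdef ▸ Real.sqrt_nonneg _
  have hn0 : 0 ≤ n := hndef ▸ Real.sqrt_nonneg _
  have hd2 : d ^ 2 = D := hddef ▸ Real.sq_sqrt (by linarith)
  have hτ2 : τ ^ 2 = T := hτdef ▸ Real.sq_sqrt (by linarith)
  have hρ2 : ρ ^ 2 = Real.log (1 / δ) := hρdef ▸ Real.sq_sqrt hL.le
  have hn2 : n ^ 2 = Real.log N := hndef ▸ Real.sq_sqrt (by linarith)
  have hn : 1 / 2 ≤ n := hndef ▸ Real.le_sqrt_of_sq_le (by linarith)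
  have hlog1T : Real.log (1 + T) ≤ ℓ := by
    calc Real.log (1 + T) ≤ Real.log (2 * T) := Real.log_le_log (by linarith) (by linarith)
      _ = Real.log 2 + Real.log T := Real.log_mul two_ne_zero (by linarith)
      _ ≤ ℓ := by linarith [Real.log_two_lt_d9]
  have hlog1T0 : 0 ≤ Real.log (1 + T) := Real.log_nonneg (by linarith)
  have hlogδ : Real.log (2 / δ) ≤ 1 + ρ ^ 2 := by
    rw [hρ2, show 2 / δ = 2 * (1 / δ) by ring, Real.log_mul two_ne_zero (by positivity)]
    linarith [Real.log_two_lt_d9]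
  have hκle : κ ≤ √(4 * Real.log (2 * m) + 6) * (n * ℓ) := by
    rw [hκ, hℓdef]
    exact sqrt_log_card_le hm1 (by linarith) hT' hlN hn0 hn2
  have hκ0 : 0 ≤ κ := hκ ▸ Real.sqrt_nonneg _
  have hrate : rate N D T ε δ =
      n * (d ^ 2 * τ + d * τ * ρ + ρ ^ 2 * τ + (d ^ 2 * τ ^ 2 + τ ^ 2 * (d * ρ)) * ε) := by
    rw [rate, Real.sqrt_mul (by positivity), Real.sqrt_mul (by positivity),
      Real.sqrt_mul (by positivity), hd2, hτ2, hρ2, hddef, hτdef, hρdef, hndef]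
  obtain ⟨c₁, hc₁⟩ : ∃ c₁, c₁ = 2 * R + √lam * B + 2 := ⟨_, rfl⟩
  obtain ⟨c₂, hc₂⟩ : ∃ c₂, c₂ = (2 + √(4 * Real.log (2 * m) + 6)) * (1 + 4 / p) := ⟨_, rfl⟩
  obtain ⟨k, hkdef⟩ : ∃ k, k = (1 + κ) * (1 + 4 / p) := ⟨_, rfl⟩
  rw [← hkdef, ← hc₁, ← hc₂, hrate, ← hℓdef]
  clear hrate
  have hc₁0 : 0 ≤ c₁ := by rw [hc₁]; positivity
  have hk0 : 0 ≤ k := by rw [hkdef]; positivity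
  have hkle : k ≤ c₂ * (n * ℓ) := by
    have h1 : 1 ≤ 2 * (n * ℓ) := by nlinarith
    calc k ≤ (2 * (n * ℓ) + √(4 * Real.log (2 * m) + 6) * (n * ℓ)) * (1 + 4 / p) := by
          rw [hkdef]; gcongr
      _ = _ := by rw [hc₂]; ring
  have hwidth : √(2 * (T * (D * Real.log (1 + T)))) ≤ 2 * (τ * d * ℓ) :=
    sqrt_width_le hd2 hτ2 (by linarith) (by linarith) hℓ hlog1T
  have hv0 : 0 ≤ v := by rw [hv]; positivity
  have hvle : v ≤ c₁ * (ℓ * (d + ρ + ε * (τ * d))) := by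
    have h1 : √(D * Real.log (1 + T) + 2 * Real.log (2 / δ)) ≤ 2 * (ℓ * (d + ρ)) :=
      sqrt_radius_le hd2 hd hρ hℓ hlog1T hlogδ
    have h2 : √lam * B * 1 ≤ √lam * B * (ℓ * (d + ρ)) := by
      gcongr
      exact one_le_mul_of_one_le_of_one_le hℓ (by linarith)
    have h3 := mul_le_mul_of_nonneg_left h1 hR
    have h4 := mul_le_mul_of_nonneg_left hwidth hε
    have h5 : 0 ≤ (2 * R + √lam * B) * (ℓ * (ε * (τ * d))) := by positivity
    have h6 : 0 ≤ ℓ * (d + ρ) := by positivity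
    rw [hv, hc₁]
    linarith
  have hsqrt : √(2 * T * Real.log (2 / δ)) ≤ 2 * (τ * (d + ρ)) := by
    rw [← hτ2]
    exact sqrt_deviation_le hd (by linarith) hρ hlogδ
  have hTq : T * (2 * B * q + 2 * ε) ≤ 2 * B + 2 * τ ^ 2 * ε := by
    have h1 : T * q ≤ 1 := by
      calc T * q ≤ T * (1 / T) := by gcongr
        _ = 1 := by field_simp
    have h2 := mul_le_mul_of_nonneg_left h1 (by linarith : 0 ≤ 2 * B)
    rw [hτ2]
    linarith
  have hq1 : 2 * B * q + 2 * ε ≤ 2 * B + 2 * ε := by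
    have h1 : q ≤ 1 := hqT.trans (by rw [div_le_one (by linarith)]; exact hT')
    have h2 := mul_le_mul_of_nonneg_left h1 (by linarith : 0 ≤ 2 * B)
    linarith
  refine le_trans ?_ (regret_terms_le hd hτ hρ hn hℓ hB hε hk0 hv0 hc₁0 hkle hvle)
  have hkv : 0 ≤ k * v := mul_nonneg hk0 hv0
  have h1 : (2 * B + k * v + (2 * B * q + 2 * ε)) * √(2 * T * Real.log (2 / δ)) ≤
      (4 * B + k * v + 2 * ε) * (2 * (τ * (d + ρ))) :=
    mul_le_mul (by linarith) hsqrt (Real.sqrt_nonneg _) (by positivity)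
  have h2 := mul_le_mul_of_nonneg_left hwidth hkv
  linarith

end Bounds

end MisspecifiedBandit

namespace MisspecifiedBandit

/-! ### The regret bound -/

section Main

variable {Ω 𝒜 : Type*} {D T : ℕ} {B ε R lam δ κ q p v : ℝ} {M : Model 𝒜 D B ε}
  {x : ℕ → Ω → 𝒜} {y η : ℕ → Ω → ℝ} {μ : ℕ → Ω → EuclideanSpace ℝ (Fin D)}

/-- A single action has no regret. -/
lemma Model.regret_eq_zero_of_card_eq_one [Fintype 𝒜] [Nonempty 𝒜] (M : Model 𝒜 D B ε)
    (h : Fintype.card 𝒜 = 1) (x : ℕ → 𝒜) : M.regret T x = 0 := by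
  have : Subsingleton 𝒜 := Fintype.card_le_one_iff_subsingleton.1 h.le
  refine Finset.sum_eq_zero fun t _ => ?_
  obtain ⟨s, hs⟩ := M.exists_mean_eq_iSup
  rw [← hs, Subsingleton.elim s (x t), sub_self]

/-- The regret on the event that all estimates are accurate and the accumulated excess regret is
at most `u`. -/
lemma regret_le_of_isAccurate {k r u : ℝ} (hlam : 1 ≤ lam) (hk : 0 ≤ k) (hv0 : 0 ≤ v) {ω : Ω}
    (hv : ∀ t < T, sampleScale R B ε lam δ (fun s => M.feat (x s ω)) t ≤ v)
    (hacc : ∀ t < T, IsAccurate M R lam δ x y t ω)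
    (hu : ∑ t ∈ Finset.Icc 1 T, excess M R lam δ k r x y (t - 1) (ω, x t ω) ≤ u) :
    M.regret T (fun t => x t ω) ≤
      u + k * v * √(2 * (T * (D * Real.log (1 + T)))) + T * r := by
  have hstep : ∀ t ∈ Finset.Icc 1 T, (⨆ a, M.mean a) - M.mean (x t ω) ≤
      excess M R lam δ k r x y (t - 1) (ω, x t ω) + k * v *
        invNorm (designMatrix lam (fun s => M.feat (x s ω)) (t - 1)) (M.feat (x t ω)) + r := by
    intro t ht
    rw [Finset.mem_Icc] at ht
    have htT : t - 1 < T := by omega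
    rw [excess, if_pos (hacc _ htT)]
    have h1 := mul_le_mul_of_nonneg_left (mul_le_mul_of_nonneg_right (hv _ htT)
      (invNorm_nonneg (designMatrix lam (fun s => M.feat (x s ω)) (t - 1)) (M.feat (x t ω)))) hk
    rw [← mul_assoc k v] at h1
    linarith
  refine (Finset.sum_le_sum hstep).trans ?_
  rw [Finset.sum_add_distrib, Finset.sum_add_distrib, ← Finset.mul_sum]
  have h2 := mul_le_mul_of_nonneg_left (sum_invNorm_le hlam
    (z := fun s => M.feat (x s ω)) (fun s => M.norm_feat_le _) T) (mul_nonneg hk hv0)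
  simp only [Finset.sum_const, Nat.card_Icc, Nat.add_sub_cancel, nsmul_eq_mul]
  linarith

variable [mΩ : MeasurableSpace Ω] {P : Measure Ω} [IsProbabilityMeasure P] {ℱ : Filtration ℕ mΩ}
  [Fintype 𝒜] [Nonempty 𝒜] [MeasurableSpace 𝒜] [MeasurableSingletonClass 𝒜]

/-- The regret bound in terms of the sampling parameters. The failure probability is split evenly
between the confidence ellipsoids and the Azuma–Hoeffding inequality for the excess regret. -/
lemma IsThompsonSampling.le_measureReal_regret_le (hI : IsInteraction M R T P ℱ x y η)
    (hTS : IsThompsonSampling M R lam δ T P x y μ) (hT : 1 ≤ T) (hR : 0 ≤ R) (hB : 0 < B)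
    (hlam : 1 ≤ lam) (hε : 0 ≤ ε) (hδ : 0 < δ) (hδ1 : δ < 1) (hκ : 0 ≤ κ)
    (hp : p = (gaussianReal 0 1).real (Set.Ici 1))
    (hq : Fintype.card 𝒜 * (2 * Real.exp (-(κ ^ 2 / 2))) ≤ q) (hqp : q ≤ p / 2)
    (hv : v = R * √(D * Real.log (1 + T) + 2 * Real.log (2 / δ)) + √lam * B +
      ε * √(2 * (T * (D * Real.log (1 + T))))) :
    1 - δ ≤ P.real {ω | M.regret T (fun t => x t ω) ≤
      (2 * B + (1 + κ) * (1 + 4 / p) * v + (2 * B * q + 2 * ε)) * √(2 * T * Real.log (2 / δ)) +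
      (1 + κ) * (1 + 4 / p) * v * √(2 * (T * (D * Real.log (1 + T)))) +
      T * (2 * B * q + 2 * ε)} := by
  have hp0 : 0 < p := hp ▸ gaussianReal_real_Ici_pos 1
  have hq0 : 0 ≤ q := le_trans (by positivity) hq
  have hv0 : 0 ≤ v := by rw [hv]; positivity
  set k := (1 + κ) * (1 + 4 / p) with hkdef
  set r := 2 * B * q + 2 * ε with hrdef
  have hk : 0 ≤ k := by positivity
  have hr : 0 ≤ r := by positivity
  set c := 2 * B + k * v + r
  have hc : 0 < c := by positivity
  set L := Real.log (2 / δ)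
  have hL : 0 < L := Real.log_pos (by rw [lt_div_iff₀ hδ]; linarith)
  have hT0 : (0 : ℝ) < T := by exact_mod_cast hT
  have hscale : ∀ ω, ∀ t ≤ T, sampleScale R B ε lam δ (fun s => M.feat (x s ω)) t ≤ v :=
    fun ω t ht => (sampleScale_le hR hlam hε hδ (fun s => M.norm_feat_le _) ht).trans_eq hv.symm
  let X : ℕ → Ω → ℝ := fun t ω => excess M R lam δ k r x y (t - 1) (ω, x t ω)
  have hXb : ∀ t < T, ∀ ω, |X (t + 1) ω| ≤ c := fun t ht ω =>
    abs_excess_le hR hε hlam hk hr (hscale ω t ht.le) _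
  have hXm : ∀ t < T, Measurable[history x y (t + 1)] (X (t + 1)) := by
    intro t ht
    have h1 : Measurable[history x y (t + 1)] (x (t + 1)) :=
      measurable_action_history (Finset.mem_Icc.2 ⟨by omega, le_rfl⟩)
    have hg : @Measurable _ _ ((history x y (t + 1)).prod inferInstance) _
        (excess M R lam δ k r x y t) :=
      @measurable_excess _ _ _ _ _ _ _ _ _ _ _ _ _ _ _ _ _ (history x y (t + 1))
        (fun s hs => measurable_action_history (Finset.Icc_subset_Icc_right t.le_succ hs))
        (fun s hs => measurable_reward_history (Finset.Icc_subset_Icc_right t.le_succ hs))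
    exact hg.comp (measurable_id.prodMk h1)
  -- the exponent `s = √(2 L / T) / c` is optimal in the Azuma–Hoeffding inequality
  have hazuma := measure_le_sum_le_of_condExp_nonpos (P := P) (history x y) (T := T) (X := X)
    (fun s t hst _ => history_mono x y hst) (fun t ht => hI.history_le ht) hXm hc
    (s := √(2 * L / T) / c) (by positivity) hXb
    (fun t ht => hTS.condExp_excess_nonpos hI hR hlam hε hκ hp hq hqp ht (hXb t ht))
    (c * √(2 * T * L))
  have hexp : (T : ℝ) * ((√(2 * L / T) / c) ^ 2 * c ^ 2 / 2) -
      √(2 * L / T) / c * (c * √(2 * T * L)) = -L := by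
    have h1 : √(2 * L / T) * √(2 * T * L) = 2 * L := by
      rw [← Real.sqrt_mul (by positivity), show 2 * L / T * (2 * T * L) = (2 * L) ^ 2 by
        field_simp, Real.sqrt_sq (by positivity)]
    have h2 : √(2 * L / T) ^ 2 = 2 * L / T := Real.sq_sqrt (by positivity)
    rw [div_pow, h2]
    have h3 : √(2 * L / T) / c * (c * √(2 * T * L)) = √(2 * L / T) * √(2 * T * L) := by
      field_simp
    rw [h3, h1]
    field_simp
    ring
  rw [hexp, Real.exp_neg, Real.exp_log (by positivity), inv_div] at hazuma
  have hconf := hI.measure_exists_sampleScale_lt_le hR hlam hε hδ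
  set S := {ω | M.regret T (fun t => x t ω) ≤ c * √(2 * T * L) +
    k * v * √(2 * (T * (D * Real.log (1 + T)))) + T * r}
  set E₁ := {ω | c * √(2 * T * L) ≤ ∑ t ∈ Finset.Icc 1 T, X t ω}
  set E₂ := {ω | ∃ t ≤ T, ∃ v, sampleScale R B ε lam δ (fun s => M.feat (x s ω)) t *
        invNorm (designMatrix lam (fun s => M.feat (x s ω)) t) v <
      |⟪leastSquares lam (fun s => M.feat (x s ω)) (fun s => y s ω) t - M.θ, v⟫|}
  have hcover : Set.univ ⊆ S ∪ (E₁ ∪ E₂) := by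
    intro ω _
    by_contra hω
    simp only [Set.mem_union, not_or] at hω
    obtain ⟨hS, h1, h2⟩ := hω
    refine hS (regret_le_of_isAccurate hlam hk hv0 (fun t ht => hscale ω t ht.le)
      (fun t ht b => ?_) (not_le.1 h1).le)
    by_contra hcon
    exact h2 ⟨t, ht.le, _, not_le.1 hcon⟩
  have h1 : P.real E₁ ≤ δ / 2 := ENNReal.toReal_le_of_le_ofReal (by positivity) hazuma
  have h2 : P.real E₂ ≤ δ / 2 := ENNReal.toReal_le_of_le_ofReal (by positivity) hconf
  have h3 : P.real Set.univ ≤ P.real S + (P.real E₁ + P.real E₂) :=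
    (measureReal_mono hcover).trans ((measureReal_union_le _ _).trans
      (add_le_add_right (measureReal_union_le _ _) _))
  rw [probReal_univ] at h3
  linarith

end Main

end MisspecifiedBandit

theorem mainTheorem10 :
    ∃ c : ℕ, ∀ R B lam : ℝ, 0 ≤ R → 0 < B → 1 ≤ lam → ∃ C : ℝ, 0 < C ∧
      ∀ (Ω : Type*) [mΩ : MeasurableSpace Ω] (P : Measure Ω) [IsProbabilityMeasure P]
        (𝒜 : Type*) [Fintype 𝒜] [Nonempty 𝒜] [MeasurableSpace 𝒜] [MeasurableSingletonClass 𝒜]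
        (D T : ℕ) (ε δ : ℝ) (M : MisspecifiedBandit.Model 𝒜 D B ε) (ℱ : Filtration ℕ mΩ)
        (x : ℕ → Ω → 𝒜) (y η : ℕ → Ω → ℝ) (μ : ℕ → Ω → EuclideanSpace ℝ (Fin D)),
        1 ≤ D → 1 ≤ T → 0 ≤ ε → 0 < δ → δ < 1 →
        MisspecifiedBandit.IsInteraction M R T P ℱ x y η →
        MisspecifiedBandit.IsThompsonSampling M R lam δ T P x y μ →
        1 - δ ≤ P.real {ω | M.regret T (fun t => x t ω) ≤
          C * (1 + Real.log T) ^ c * MisspecifiedBandit.rate (Fintype.card 𝒜) D T ε δ} := by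
  obtain ⟨p, hp⟩ : ∃ p, p = (gaussianReal 0 1).real (Set.Ici 1) := ⟨_, rfl⟩
  have hp0 : 0 < p := hp ▸ gaussianReal_real_Ici_pos 1
  obtain ⟨m, hm⟩ := exists_nat_gt (2 / p)
  have hm0 : (0 : ℝ) < m := lt_trans (by positivity) hm
  have hm1 : (1 : ℝ) ≤ m := by exact_mod_cast Nat.one_le_iff_ne_zero.2 (by rintro rfl; simp at hm0)
  refine ⟨3, fun R B lam hR hB hlam =>
    ⟨8 * ((2 * R + √lam * B + 2) * ((2 + √(4 * Real.log (2 * m) + 6)) * (1 + 4 / p))) +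
      20 * B + 12, by positivity, ?_⟩⟩
  intro Ω mΩ P _ 𝒜 _ _ _ _ D T ε δ M ℱ x y η μ hD hT hε hδ hδ1 hI hTS
  -- for a single arm the rate vanishes, and so does the regret
  rcases (Nat.one_le_iff_ne_zero.2 (Fintype.card_ne_zero (α := 𝒜))).eq_or_lt with hN | hN
  · refine le_trans (b := 1) (by linarith) (le_of_eq ?_)
    rw [← probReal_univ (μ := P)]
    congr 1
    refine (Set.eq_univ_of_forall fun ω => ?_).symm
    simp [M.regret_eq_zero_of_card_eq_one hN.symm, MisspecifiedBandit.rate, ← hN]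
  have hT' : (1 : ℝ) ≤ T := by exact_mod_cast hT
  have hqT : 1 / (m * T : ℝ) ≤ 1 / T :=
    one_div_le_one_div_of_le (by linarith) (le_mul_of_one_le_left (by linarith) hm1)
  have hqp : 1 / (m * T : ℝ) ≤ p / 2 := by
    have h1 : 1 / (m * T : ℝ) ≤ 1 / m :=
      one_div_le_one_div_of_le hm0 (le_mul_of_one_le_right hm0.le hT')
    have h2 : 1 / (m : ℝ) ≤ 1 / (2 / p) := one_div_le_one_div_of_le (by positivity) hm.le
    rw [one_div_div] at h2
    linarith
  refine (hTS.le_measureReal_regret_le hI hT hR hB hlam hε hδ hδ1 (Real.sqrt_nonneg _) hp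
    (MisspecifiedBandit.mul_exp_neg_sq_le hm1 (by exact_mod_cast hN.le) hT') hqp rfl).trans
    (measureReal_mono fun ω hω => le_trans (Set.mem_ofPred_eq.mp hω) ?_)
  exact MisspecifiedBandit.regret_bound_le_rate hN hD hT hR hB.le hε hδ hδ1 hp0 hm1 rfl hqT rfl
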